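/- **Model.** There are $\mathbf n$ replicas with identifiers $0,\dots,\mathbf n-1$, a set $\mathcal F$ of which, $|\mathcal F|=\mathbf f$, is Byzantine; put $\mathbf{nf}=\mathbf n-\mathbf f$. Time is discrete. Non-faulty replicas are deterministic and follow the protocol below: in every tick a replica takes in arriving messages and runs all enabled rules. Byzantine replicas send arbitrary messages, clients are arbitrary, and the network may lose, delay, reorder and duplicate messages; but nobody can impersonate a non-faulty replica or forge its signature shares or its signed messages. A threshold signature $\langle h\rangle$ aggregates the signature shares for $h$ of $\mathbf{nf}$ distinct replicas. The primary of view $v$ is the replica $v \bmod \mathbf n$; all replicas start in view $0$ with nothing executed. **Protocol PoE (with threshold signatures).** Replicas remember all messages they receive. A request is *waiting* at a replica that received it and at which it is not executed (or was reverted). *Normal case, in view $v$.* A replica forwards requests from clients to the primary. The primary proposes each waiting request $T$ by broadcasting $\textsc{propose}(T,v,k)$, with consecutive sequence numbers $k$ from $k_{\max}+1$ on (see below; in view $0$, from $0$ on). A replica supports the first $k$-th proposal of view $v$ it gets by sending the primary a signature share of $(T,v,k)$. With shares of $\mathbf{nf}$ distinct replicas the primary broadcasts $\textsc{certify}$ with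 the threshold signature. A replica that supported $T$ view-commits to $T$ on receiving it, and executes $T$ as the $k$-th transaction as soon as it has executed $k-1$ (or $k=0$). *View-change.* Each waiting request has a timer, restarted whenever the replica requests a view-change. A replica in view $v$ requests a view-change when a timer expires, or when it received $\textsc{vc-request}$s for $v$ from $\mathbf f+1$ distinct replicas: it halts view $v$ and broadcasts a signed $\textsc{vc-request}(v,E)$, where $E$ is the sequence of transactions it executed, each with its threshold signature. If a timer expires again while it waits for view $v+1$, it moves on, halted, to $v+1$ and broadcasts $\textsc{vc-request}(v+1,E)$. The timeout is $\delta$ at first and doubles with each view-change: it is $\delta 2^{v}$ in view $v$ and $\delta 2^{v+1}$ while halted in $v$, waiting for view $v+1$. The primary of $v+1$, while in view $v$, broadcasts $\textsc{nv-propose}(v+1,\dots)$ with valid requests for $v$ of $\mathbf{nf}$ distinct replicas (valid: $E$ is consecutive from $0$ and certified). A replica that halted view $v$ and gets a valid such proposal makes the longest $E'$ in it its sequence of executed transactions (executing what is missing, rolling back what is not in $E'$), enters view $v+1$ with $k_{\max}+1=|E'|$, and forwards its waiting requests to the new primary. *Checkpoints.* Every replica broadcasts its certified sequence of executed transactions whenever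 it changes, and also every $P$ ticks. Valid checkpoints are kept until the replica is halted; a halted replica looks at them in order of arrival, and moves to the sequence of each one in which some request waiting at it is executed. **Theorem (Liveness of PoE).** Let $\mathbf n>3\mathbf f$, $\delta>0$ and $P>0$. PoE provides termination in periods of reliable bounded-delay communication: for all $\Delta$ and $V$ there is an $L$, depending only on $\mathbf n$, $\mathcal F$, $\delta$, $P$, $\Delta$ and $V$, such that the following holds for every run of PoE and every time $a$. Suppose that communication is reliable from $a$ to $a+L$ with maximum delay $\Delta$ (every message sent by a non-faulty replica to a non-faulty replica at a time $s$ with $a\le s\le a+L-\Delta$ arrives at a time in $(s,s+\Delta]$), and that at time $a$ the current view of every non-faulty replica is at most $V$. Then for every request $T$ that every non-faulty replica has received by time $a$, every non-faulty replica executes $T$ between $a$ and $a+L$, unless it has $T$ executed (and not reverted) at time $a$ already. -/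

import Mathlib

/-!
# The consensus protocol PoE (Proof-of-Execution), with threshold signatures

Replicas are the elements of `Fin n` (the identifier of a replica is its value).  The type `Req`
is the type of client requests, i.e. of transactions signed by their client.  Replicas are
deterministic state machines.  Time is discrete: at every tick a replica takes in the client
requests and the messages that arrive at this tick, runs all rules of the protocol that are enabled,
and sends messages.

Cryptography is symbolic: the value `h = Hash (k || v || T)` is represented by the triple
`(T, v, k)`, a threshold signature by the set of replicas whose signature shares it aggregates.
-/

namespace PoE

/-- The constants known to all replicas. -/
structure Config where
  /-- the number of faulty replicas -/
  f : ℕ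
  /-- the timeout with which replicas start -/
  δ : ℕ
  /-- the period of the checkpoint protocol -/
  period : ℕ

/-- The number `nf = n - f` of non-faulty replicas. -/
def Config.nf (cfg : Config) (n : ℕ) : ℕ := n - cfg.f

/-- `certify(⟨h⟩, view, seq)` with `h = Hash (seq || view || req)`; the threshold signature `⟨h⟩`
aggregates the signature shares of the replicas in `signers`. -/
structure Cert (n : ℕ) (Req : Type*) where
  req : Req
  view : ℕ
  seq : ℕ
  signers : Finset (Fin n)
  deriving DecidableEq

/-- A signed view-change request `vc-request(view, log)` of the replica `sender`. -/
structure VcRequest (n : ℕ) (Req : Type*) where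
  sender : Fin n
  view : ℕ
  log : List (Cert n Req)

inductive Msg (n : ℕ) (Req : Type*) where
  /-- a client request, forwarded by a replica -/
  | request (T : Req)
  | propose (T : Req) (v k : ℕ)
  /-- carries the signature share of its sender for `Hash (k || v || T)` -/
  | support (T : Req) (v k : ℕ)
  | certify (c : Cert n Req)
  | vcRequest (m : VcRequest n Req)
  | nvPropose (v : ℕ) (ms : List (VcRequest n Req))
  /-- the transactions executed by the sender, each with its certificate -/
  | checkpoint (log : List (Cert n Req))

/-- A certificate is valid if it aggregates shares of `nf` distinct replicas. -/
def Cert.valid {n : ℕ} {Req : Type*} (cfg : Config) (c : Cert n Req) : Bool :=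
  decide (cfg.nf n ≤ c.signers.card)

/-- A consecutive sequence (starting at sequence number `0`) of certified transactions. -/
def validLog {n : ℕ} {Req : Type*} (cfg : Config) (E : List (Cert n Req)) : Bool :=
  decide (E.map Cert.seq = List.range E.length) && E.all (Cert.valid cfg)

/-- A new-view proposal for view `v` is valid if it consists of valid view-change requests for view
`v - 1` of `nf` distinct replicas. -/
def validNewView {n : ℕ} {Req : Type*} (cfg : Config) (v : ℕ) (ms : List (VcRequest n Req)) :
    Bool :=
  decide ((ms.map VcRequest.sender).Nodup) && decide (ms.length = cfg.nf n) &&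
    ms.all (fun m => decide (m.view + 1 = v) && validLog cfg m.log)

/-- The longest sequence of executed transactions in a new-view proposal (the first one among
those of maximal length). -/
def longestLog {n : ℕ} {Req : Type*} (ms : List (VcRequest n Req)) : List (Cert n Req) :=
  ms.foldl (fun E m => if E.length < m.log.length then m.log else E) []

/-- The primary of view `v`. -/
def primary (n : ℕ) [NeZero n] (v : ℕ) : Fin n := Fin.ofNat n v

/-- The local state of a replica. -/
structure State (n : ℕ) (Req : Type*) where
  /-- the current view -/
  view : ℕ
  /-- the replica has detected failure of the primary of `view`, has requested a view-change and has
  halted the normal-case algorithm -/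
  halted : Bool
  /-- the executed (and not reverted) transactions, in order of execution -/
  log : List (Cert n Req)
  /-- the client requests received so far, from clients or from replicas that forward them -/
  known : List Req
  /-- the messages received so far, with their senders -/
  inbox : List (Fin n × Msg n Req)
  /-- `(T, v, k)` is listed if the replica supported `T` as the `k`-th transaction of view `v` -/
  supported : List (Req × ℕ × ℕ)
  /-- the first sequence number of the current view, i.e. `k_max + 1` -/
  base : ℕ
  /-- as a primary: the requests proposed in the current view, with sequence numbers `base`,
  `base + 1`, ... -/
  proposed : List Req
  /-- as a primary: the sequence numbers of the current view for which `certify` was broadcast -/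
  certified : List ℕ
  /-- as a new primary: the last view that was proposed -/
  lastNewView : ℕ
  /-- the timers: for how many ticks a request has been waiting for its execution, since the last
  time that the replica requested a view-change -/
  timer : Req → ℕ
  /-- the checkpoints that were received and not yet looked at -/
  checkpoints : List (List (Cert n Req))
  /-- the number of ticks so far -/
  clock : ℕ

/-- The initial state: every replica is in view `0` and has not executed anything. -/
def State.init (n : ℕ) (Req : Type*) : State n Req where
  view := 0
  halted := false
  log := []
  known := []
  inbox := []
  supported := []
  base := 0
  proposed := []
  certified := []
  lastNewView := 0
  timer := fun _ => 0
  checkpoints := []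
  clock := 0

/-- The progress of a replica within one tick: its state, the messages sent so far in this tick
(with their destination) and the executions performed so far in this tick.  (After the execution of
a transaction the replica also informs the client; replicas never receive anything in return, so
that these messages are not represented.) -/
structure Progress (n : ℕ) (Req : Type*) where
  st : State n Req
  out : List (Fin n × Msg n Req)
  execs : List (Cert n Req)

section Rules

variable {n : ℕ} [NeZero n] {Req : Type*} [DecidableEq Req]

/-- `T` is waiting for its execution: it was received, and it is not executed (or it was
reverted). -/
def State.pending (s : State n Req) (T : Req) : Bool :=
  decide (T ∈ s.known) && decide (T ∉ s.log.map Cert.req)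

/-- The timeout: `δ` at first, doubled after each view-change. A replica that requests to replace
the primary of view `v` is already waiting for view `v + 1`. -/
def State.timeout (cfg : Config) (s : State n Req) : ℕ :=
  cfg.δ * 2 ^ (if s.halted then s.view + 1 else s.view)

def broadcast (m : Msg n Req) : List (Fin n × Msg n Req) :=
  (List.finRange n).map (fun r => (r, m))

def Progress.send (a : Progress n Req) (ms : List (Fin n × Msg n Req)) : Progress n Req :=
  { a with out := a.out ++ ms }

/-- Make `E` the sequence of executed transactions: roll back the transactions that are not
in `E`, execute those transactions of `E` that are not executed yet. -/
def Progress.moveTo (a : Progress n Req) (E : List (Cert n Req)) : Progress n Req :=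
  { a with
    st := { a.st with log := E }
    execs := a.execs ++ E.filter (fun c => decide (c ∉ a.st.log)) }

/-- Take in the requests `reqs` that arrive from clients and the messages `ms` that arrive from
replicas.  Requests from clients are forwarded to the current primary unless already executed. -/
def receive (cfg : Config) (reqs : List Req) (ms : List (Fin n × Msg n Req)) (a : Progress n Req) :
    Progress n Req :=
  let s := a.st
  let a' : Progress n Req := { a with
    st := { s with
      known := s.known ++ reqs ++ ms.filterMap (fun x => match x.2 with
        | .request T => some T
        | _ => none)
      inbox := s.inbox ++ ms
      checkpoints := s.checkpoints ++ ms.filterMap (fun x => match x.2 with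
        | .checkpoint E => if validLog cfg E then some E else none
        | _ => none)
      clock := s.clock + 1 } }
  if s.halted then a' else
    a'.send ((reqs.filter a'.st.pending).map (fun T => (primary n s.view, .request T)))

/-- Checkpoint protocol, recovery: a replica that was left in the dark (it is waiting for the
execution of some request and has halted its view) moves to the state of a checkpoint in which such
a request is executed.  The checkpoints are looked at one after the other, in order of
arrival. -/
def catchUp (a : Progress n Req) : Progress n Req :=
  if a.st.halted then
    let b := a.st.checkpoints.foldl
      (fun b E => if E.any (fun c => b.st.pending c.req) then b.moveTo E else b) a
    { b with st := { b.st with checkpoints := [] } }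
  else a

/-- View-change, on receiving a valid `nv-propose` for the next view from its primary: move to the
longest sequence of executed transactions in it and enter the new view.  Waiting requests are
forwarded to the new primary. -/
def enterView (cfg : Config) (a : Progress n Req) : Progress n Req :=
  let s := a.st
  if s.halted then
    match s.inbox.findSome? (fun x => match x.2 with
        | .nvPropose v ms =>
            if x.1 = primary n v ∧ v = s.view + 1 ∧ validNewView cfg v ms then some ms else none
        | _ => none) with
    | none => a
    | some ms =>
      let b := a.moveTo (longestLog ms)
      let b : Progress n Req := { b with
        st := { b.st with
          view := s.view + 1
          halted := false
          base := (longestLog ms).length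
          proposed := []
          certified := [] } }
      b.send ((b.st.known.filter b.st.pending).map
        (fun T => (primary n (s.view + 1), .request T)))
  else a

/-- Backup role: support the first `k`-th proposal of the primary of the current view. -/
def supportProposals (a : Progress n Req) : Progress n Req :=
  if a.st.halted then a else
    a.st.inbox.foldl (fun b x => match x.2 with
      | .propose T v k =>
          if x.1 = primary n v ∧ v = b.st.view ∧ b.st.base ≤ k ∧
              ∀ y ∈ b.st.supported, y.2 ≠ (v, k) then
            ({ b with st := { b.st with supported := b.st.supported ++ [(T, v, k)] } }
              : Progress n Req).send [(primary n v, .support T v k)]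
          else b
      | _ => b) a

/-- The replica view-commits to the transaction of `c`, upon the message `certify c` from `p`. -/
def viewCommits (cfg : Config) (s : State n Req) (p : Fin n) (c : Cert n Req) : Bool :=
  decide (p = primary n c.view ∧ c.view = s.view ∧ (c.req, c.view, c.seq) ∈ s.supported) &&
    c.valid cfg

/-- Backup role: execute the next transaction if the replica has view-committed to it. -/
def executeNext (cfg : Config) (a : Progress n Req) : Progress n Req :=
  match a.st.inbox.findSome? (fun x => match x.2 with
      | .certify c =>
          if viewCommits cfg a.st x.1 c ∧ c.seq = a.st.log.length then some c else none
      | _ => none) with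
  | none => a
  | some c => { a with st := { a.st with log := a.st.log ++ [c] }, execs := a.execs ++ [c] }

/-- Backup role: execute view-committed transactions, in order, as far as possible (every
execution uses up a received message). -/
def execute (cfg : Config) (a : Progress n Req) : Progress n Req :=
  if a.st.halted then a else (executeNext cfg)^[a.st.inbox.length] a

/-- Primary role: propose every waiting request, with the next sequence number. -/
def proposeRequests (me : Fin n) (a : Progress n Req) : Progress n Req :=
  if ¬ a.st.halted ∧ me = primary n a.st.view then
    a.st.known.foldl (fun b T =>
      if b.st.pending T ∧ T ∉ b.st.proposed then
        ({ b with st := { b.st with proposed := b.st.proposed ++ [T] } } : Progress n Req).send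
          (broadcast (.propose T b.st.view (b.st.base + b.st.proposed.length)))
      else b) a
  else a

/-- The replicas whose signature share for `Hash (k || v || T)` was received. -/
def supporters (s : State n Req) (T : Req) (v k : ℕ) : Finset (Fin n) :=
  Finset.univ.filter (fun p => s.inbox.any (fun x => decide (x.1 = p) && match x.2 with
    | .support T' v' k' => decide (T' = T ∧ v' = v ∧ k' = k)
    | _ => false))

/-- Primary role: aggregate `nf` signature shares for a proposal and broadcast the result. -/
def certifyProposals (cfg : Config) (me : Fin n) (a : Progress n Req) : Progress n Req :=
  if ¬ a.st.halted ∧ me = primary n a.st.view then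
    a.st.proposed.zipIdx.foldl (fun b x =>
      let k := b.st.base + x.2
      let S := supporters b.st x.1 b.st.view k
      if k ∉ b.st.certified ∧ cfg.nf n ≤ S.card then
        ({ b with st := { b.st with certified := b.st.certified ++ [k] } } : Progress n Req).send
          (broadcast (.certify ⟨x.1, b.st.view, k, S⟩))
      else b) a
  else a

/-- The replicas from which a view-change request for view `v` was received. -/
def complainers (s : State n Req) (v : ℕ) : Finset (Fin n) :=
  Finset.univ.filter (fun p => s.inbox.any (fun x => match x.2 with
    | .vcRequest m => decide (m.sender = p ∧ m.view = v)
    | _ => false))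

/-- Advance the timers of the waiting requests, and stop all others. -/
def advanceTimers (a : Progress n Req) : Progress n Req :=
  { a with st := { a.st with
      timer := fun T => if a.st.pending T then a.st.timer T + 1 else 0 } }

/-- Halt view `v`, broadcast `vc-request(v, E)` and restart all timers. -/
def requestViewChange (me : Fin n) (v : ℕ) (a : Progress n Req) : Progress n Req :=
  ({ a with st := { a.st with view := v, halted := true, timer := fun _ => 0 } }
    : Progress n Req).send (broadcast (.vcRequest ⟨me, v, a.st.log⟩))

/-- Failure detection.  When a timer expires, the primary of the current view is considered faulty,
or the next primary if a change to its view has already been requested.  Moreover, a replica joins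
a view-change for its current view that `f + 1` distinct replicas request. -/
def detectFailure (cfg : Config) (me : Fin n) (a : Progress n Req) : Progress n Req :=
  let s := a.st
  if s.known.any (fun T => s.pending T && decide (s.timeout cfg ≤ s.timer T)) then
    requestViewChange me (if s.halted then s.view + 1 else s.view) a
  else if ¬ s.halted ∧ cfg.f + 1 ≤ (complainers s s.view).card then
    requestViewChange me s.view a
  else a

/-- The first valid view-change request of replica `p` for view `v` that was received. -/
def firstVcRequest (cfg : Config) (s : State n Req) (v : ℕ) (p : Fin n) :
    Option (VcRequest n Req) :=
  s.inbox.findSome? (fun x => match x.2 with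
    | .vcRequest m => if m.sender = p ∧ m.view = v ∧ validLog cfg m.log then some m else none
    | _ => none)

/-- View-change, role of the next primary: propose the new view as soon as valid view-change
requests for the current view from `nf` distinct replicas have been received. -/
def proposeView (cfg : Config) (me : Fin n) (a : Progress n Req) : Progress n Req :=
  let s := a.st
  let ms := (List.finRange n).filterMap (firstVcRequest cfg s s.view)
  if me = primary n (s.view + 1) ∧ s.lastNewView < s.view + 1 ∧ cfg.nf n ≤ ms.length then
    ({ a with st := { s with lastNewView := s.view + 1 } } : Progress n Req).send
      (broadcast (.nvPropose (s.view + 1) (ms.take (cfg.nf n))))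
  else a

/-- Checkpoint protocol, sending: broadcast the executed transactions with their certificates,
periodically and whenever they differ from those at the beginning `old` of the tick. -/
def sendCheckpoint (cfg : Config) (old : List (Cert n Req)) (a : Progress n Req) :
    Progress n Req :=
  if a.st.clock % cfg.period = 0 ∨ a.st.log ≠ old then a.send (broadcast (.checkpoint a.st.log))
  else a

/-- What replica `me` in state `s` does in one tick, at which the requests `reqs` arrive from
clients and the messages `ms` arrive from replicas. -/
def tick (cfg : Config) (me : Fin n) (s : State n Req) (reqs : List Req)
    (ms : List (Fin n × Msg n Req)) : Progress n Req :=
  ⟨s, [], []⟩ |> receive cfg reqs ms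
    |> catchUp
    |> enterView cfg
    |> supportProposals
    |> execute cfg
    |> proposeRequests me
    |> certifyProposals cfg me
    |> advanceTimers
    |> detectFailure cfg me
    |> proposeView cfg me
    |> sendCheckpoint cfg s.log

end Rules

/-- The threshold signatures that a message contains. -/
def Msg.certs {n : ℕ} {Req : Type*} : Msg n Req → List (Cert n Req)
  | .certify c => [c]
  | .vcRequest m => m.log
  | .nvPropose _ ms => ms.flatMap VcRequest.log
  | .checkpoint E => E
  | _ => []

/-- The signed view-change requests that a message contains. -/
def Msg.vcRequests {n : ℕ} {Req : Type*} : Msg n Req → List (VcRequest n Req)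
  | .vcRequest m => [m]
  | .nvPropose _ ms => ms
  | _ => []

/-- A run of PoE in which the replicas in `F` are Byzantine, as seen by the non-faulty replicas.

Byzantine replicas can send arbitrary messages to arbitrary replicas at any time, and there are
no assumptions on clients (so that any request may appear anywhere).  The network may lose, delay,
reorder and duplicate messages.  Neither can impersonate a non-faulty replica, and neither can forge
a signature share or a signed view-change request of a non-faulty replica. -/
structure Run (n : ℕ) [NeZero n] (Req : Type*) [DecidableEq Req] (F : Finset (Fin n))
    (cfg : Config) where
  /-- the state of a replica at the beginning of a tick -/
  state : ℕ → Fin n → State n Req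
  /-- the requests that a replica receives from clients in a tick -/
  requests : ℕ → Fin n → List Req
  /-- the messages that a replica receives in a tick, with their senders -/
  delivered : ℕ → Fin n → List (Fin n × Msg n Req)
  state_zero : ∀ r ∉ F, state 0 r = State.init n Req
  state_succ : ∀ t, ∀ r ∉ F,
    state (t + 1) r = (tick cfg r (state t r) (requests t r) (delivered t r)).st
  authentic : ∀ t, ∀ r ∉ F, ∀ p ∉ F, ∀ m, (p, m) ∈ delivered t r →
    ∃ s < t, (r, m) ∈ (tick cfg p (state s p) (requests s p) (delivered s p)).out
  unforgeable_shares : ∀ t, ∀ r ∉ F, ∀ x ∈ delivered t r, ∀ c ∈ x.2.certs, ∀ q ∈ c.signers, q ∉ F →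
    ∃ s < t, ∃ d, (d, Msg.support c.req c.view c.seq) ∈
      (tick cfg q (state s q) (requests s q) (delivered s q)).out
  unforgeable_vcRequests : ∀ t, ∀ r ∉ F, ∀ x ∈ delivered t r, ∀ m ∈ x.2.vcRequests, m.sender ∉ F →
    ∃ s < t, ∃ d, (d, Msg.vcRequest m) ∈
      (tick cfg m.sender (state s m.sender) (requests s m.sender) (delivered s m.sender)).out

namespace Run

variable {n : ℕ} [NeZero n] {Req : Type*} [DecidableEq Req] {F : Finset (Fin n)} {cfg : Config}

/-- What replica `r` does in tick `t`. -/
def progress (ρ : Run n Req F cfg) (t : ℕ) (r : Fin n) : Progress n Req :=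
  tick cfg r (ρ.state t r) (ρ.requests t r) (ρ.delivered t r)

/-- Communication is reliable with maximum delay `Δ` in the period from `a` to `b`: messages sent
by non-faulty replicas to non-faulty replicas in this period arrive within `Δ` ticks (as far as
these lie in the period). -/
def Reliable (ρ : Run n Req F cfg) (Δ a b : ℕ) : Prop :=
  ∀ s, a ≤ s → s + Δ ≤ b → ∀ p ∉ F, ∀ r ∉ F, ∀ m, (r, m) ∈ (ρ.progress s p).out →
    ∃ t, s < t ∧ t ≤ s + Δ ∧ (p, m) ∈ ρ.delivered t r

/-- In the period from `a` to `b`, replica `r` executes `T`, unless `T` stands executed at `r` at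
its beginning. -/
def Executes (ρ : Run n Req F cfg) (r : Fin n) (T : Req) (a b : ℕ) : Prop :=
  (∃ c ∈ (ρ.state a r).log, c.req = T) ∨
    ∃ t, a ≤ t ∧ t < b ∧ ∃ c ∈ (ρ.progress t r).execs, c.req = T

end Run

end PoE

set_option linter.unusedSectionVars false

namespace PoE

/-! ### What each rule changes, what it leaves alone, and what it sends -/

section Frames

variable {n : ℕ} [NeZero n] {Req : Type*} [DecidableEq Req]

/-! Argue by contradiction: some non-faulty replica `r` does not execute `T` in the period.
Checkpoints then force `T` to wait at all non-faulty replicas for a long time, while timers and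
view-changes make such a long common wait impossible.

Checkpoints (`all_pending_of_not_executes`). If a non-faulty `q` had `T` executed at some time of
the long interval, then `q` broadcast exactly this log at most `period` ticks earlier
(`exists_checkpoint_sent`). It reaches `r`, which keeps it until halted. Since `T` waits at `r`, its
timer makes `r` halt in time, and `r` executes `T` from this checkpoint or from an earlier one
(`executes_of_delivered_checkpoint`).

Timers. The position of a replica in the sequence of views is its level `2 * view + (1 if halted)`,
which never decreases; the timeout is a function of the level. Let all levels be at most `2 * W` at
the start of the wait. Nobody lags: the timeouts form a geometric series, so `δ * 2 ^ u` ticks after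
the start every non-faulty replica has asked to replace the primary of view `u - 1` (`level_ge`).
Nobody runs ahead: a view-change needs an expired timer or `f + 1` complaints, one of which is from
a non-faulty replica, so no level exceeds `2 * u` up to `δ * (2 ^ (u + 1) - 2 ^ (W + 1))` ticks
after the start (`level_le`). Between these two times all non-faulty replicas have level `2 * u - 1`
or `2 * u`, and the length of this window grows without bound with `u`.

Views (`not_pending_of_view`). Take `u` large with a non-faulty primary. The window has room for
five message delays: view-change requests, the new-view proposal, proposals, supports, certificates.
The primary sends only one new-view proposal for `u`, so all replicas start the view with the same
`base`; only its own proposals are supported, so the slot in which it proposed `T` can be filled by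
`T` alone. Hence the primary executes `T`, although `T` was still waiting there. -/

@[simp] theorem Progress.send_frame (a : Progress n Req) (ms : List (Fin n × Msg n Req)) :
    (a.send ms).st = a.st ∧ (a.send ms).execs = a.execs ∧ (a.send ms).out = a.out ++ ms :=
  ⟨rfl, rfl, rfl⟩

theorem mem_broadcast {m : Msg n Req} {x : Fin n × Msg n Req} :
    x ∈ broadcast m ↔ x.2 = m := by
  obtain ⟨r, m'⟩ := x
  simp [broadcast, eq_comm]

/-! ### Taking in messages -/

-- Frame lemmas are conjunctions of equations tagged `simp`, so that a field of the state after
-- several rules reduces to the field before them in one call.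
@[simp] theorem receive_frame (cfg : Config) (reqs : List Req) (ms : List (Fin n × Msg n Req))
    (a : Progress n Req) :
    (receive cfg reqs ms a).st.view = a.st.view ∧
    (receive cfg reqs ms a).st.halted = a.st.halted ∧
    (receive cfg reqs ms a).st.log = a.st.log ∧
    (receive cfg reqs ms a).st.inbox = a.st.inbox ++ ms ∧
    (receive cfg reqs ms a).st.supported = a.st.supported ∧
    (receive cfg reqs ms a).st.base = a.st.base ∧
    (receive cfg reqs ms a).st.proposed = a.st.proposed ∧
    (receive cfg reqs ms a).st.certified = a.st.certified ∧
    (receive cfg reqs ms a).st.lastNewView = a.st.lastNewView ∧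
    (receive cfg reqs ms a).st.timer = a.st.timer ∧
    (receive cfg reqs ms a).st.clock = a.st.clock + 1 ∧
    (receive cfg reqs ms a).execs = a.execs := by
  unfold receive
  dsimp only
  split <;> simp

theorem known_subset_receive (cfg : Config) (reqs : List Req) (ms : List (Fin n × Msg n Req))
    (a : Progress n Req) : a.st.known ⊆ (receive cfg reqs ms a).st.known := by
  unfold receive
  dsimp only
  split <;> simp

theorem receive_checkpoints (cfg : Config) (reqs : List Req) (ms : List (Fin n × Msg n Req))
    (a : Progress n Req) (E : List (Cert n Req)) :
    E ∈ (receive cfg reqs ms a).st.checkpoints ↔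
      E ∈ a.st.checkpoints ∨ validLog cfg E = true ∧ ∃ p, (p, Msg.checkpoint E) ∈ ms := by
  have key : (receive cfg reqs ms a).st.checkpoints = a.st.checkpoints ++
      ms.filterMap (fun x => match x.2 with
        | .checkpoint E => if validLog cfg E then some E else none
        | _ => none) := by
    unfold receive
    dsimp only
    split <;> rfl
  rw [key, List.mem_append, List.mem_filterMap]
  refine or_congr Iff.rfl ⟨?_, ?_⟩
  · rintro ⟨⟨p, m⟩, hx, h⟩
    cases m <;> simp at h
    obtain ⟨h1, rfl⟩ := h
    exact ⟨h1, p, hx⟩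
  · rintro ⟨h, p, hp⟩
    exact ⟨_, hp, by simp [h]⟩

theorem receive_out (cfg : Config) (reqs : List Req) (ms : List (Fin n × Msg n Req))
    (a : Progress n Req) :
    ∀ x ∈ (receive cfg reqs ms a).out, x ∈ a.out ∨ ∃ T, x.2 = .request T := by
  unfold receive
  dsimp only
  split
  · intro x hx; exact Or.inl hx
  · intro x hx
    simp only [Progress.send_frame, List.mem_append, List.mem_map] at hx
    rcases hx with hx | ⟨T, -, rfl⟩
    · exact Or.inl hx
    · exact Or.inr ⟨T, rfl⟩

/-! ### Recovery from checkpoints -/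

theorem catchUp_shape (a : Progress n Req) :
    ∃ l c e, catchUp a =
      { a with st := { a.st with log := l, checkpoints := c }, execs := a.execs ++ e } := by
  unfold catchUp
  split
  · have h : ∃ l e, a.st.checkpoints.foldl
        (fun b E => if E.any (fun c => b.st.pending c.req) then b.moveTo E else b) a =
        { a with st := { a.st with log := l }, execs := a.execs ++ e } := by
      refine List.foldlRecOn (motive := fun b => ∃ l e, b =
        ({ a with st := { a.st with log := l }, execs := a.execs ++ e } : Progress n Req)) _ _
        ⟨a.st.log, [], by simp⟩ ?_
      rintro b ⟨l, e, rfl⟩ E -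
      split
      · exact ⟨E, _, by simp [Progress.moveTo]; rfl⟩
      · exact ⟨l, e, rfl⟩
    obtain ⟨l, e, h⟩ := h
    exact ⟨l, [], e, by dsimp only; rw [h]⟩
  · exact ⟨a.st.log, a.st.checkpoints, [], by simp⟩

@[simp] theorem catchUp_frame (a : Progress n Req) :
    (catchUp a).st.view = a.st.view ∧ (catchUp a).st.halted = a.st.halted ∧
    (catchUp a).st.known = a.st.known ∧ (catchUp a).st.inbox = a.st.inbox ∧
    (catchUp a).st.supported = a.st.supported ∧ (catchUp a).st.base = a.st.base ∧
    (catchUp a).st.proposed = a.st.proposed ∧ (catchUp a).st.certified = a.st.certified ∧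
    (catchUp a).st.lastNewView = a.st.lastNewView ∧ (catchUp a).st.timer = a.st.timer ∧
    (catchUp a).st.clock = a.st.clock ∧ (catchUp a).out = a.out := by
  obtain ⟨l, c, e, h⟩ := catchUp_shape a
  simp [h]

theorem catchUp_of_not_halted {a : Progress n Req} (h : a.st.halted = false) : catchUp a = a := by
  simp [catchUp, h]

/-! ### Entering a view -/

/-- The negative alternative also records that a halted replica has no valid proposal for the next
view in its inbox. This is what rules out that a replica stays behind once the proposal has arrived.
-/
theorem enterView_cases (cfg : Config) (a : Progress n Req) :
    (enterView cfg a = a ∧ (a.st.halted = true → ∀ ms,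
      (primary n (a.st.view + 1), Msg.nvPropose (a.st.view + 1) ms) ∈ a.st.inbox →
        validNewView cfg (a.st.view + 1) ms = false)) ∨
    (a.st.halted = true ∧ ∃ ms,
      (primary n (a.st.view + 1), Msg.nvPropose (a.st.view + 1) ms) ∈ a.st.inbox ∧
      validNewView cfg (a.st.view + 1) ms = true ∧
      (enterView cfg a).st = { (a.moveTo (longestLog ms)).st with
        view := a.st.view + 1, halted := false, base := (longestLog ms).length,
        proposed := [], certified := [] } ∧
      (enterView cfg a).execs = (a.moveTo (longestLog ms)).execs ∧
      ∃ Ts : List Req, (enterView cfg a).out =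
        a.out ++ Ts.map (fun T => (primary n (a.st.view + 1), .request T))) := by
  unfold enterView
  dsimp only
  split
  · rename_i hh
    split
    · rename_i h
      refine Or.inl ⟨rfl, fun _ ms hms => ?_⟩
      have := List.findSome?_eq_none_iff.1 h _ hms
      simpa using this
    · rename_i ms h
      obtain ⟨⟨q, m⟩, hx, h⟩ := List.exists_of_findSome?_eq_some h
      cases m <;> simp at h
      obtain ⟨⟨h1, h2, h3⟩, h4⟩ := h
      subst h1 h2 h4
      exact Or.inr ⟨hh, _, hx, h3, rfl, rfl, _, rfl⟩
  · rename_i hh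
    exact Or.inl ⟨rfl, fun h => absurd h hh⟩

@[simp] theorem enterView_frame (cfg : Config) (a : Progress n Req) :
    (enterView cfg a).st.known = a.st.known ∧ (enterView cfg a).st.inbox = a.st.inbox ∧
    (enterView cfg a).st.supported = a.st.supported ∧
    (enterView cfg a).st.lastNewView = a.st.lastNewView ∧
    (enterView cfg a).st.timer = a.st.timer ∧
    (enterView cfg a).st.checkpoints = a.st.checkpoints ∧
    (enterView cfg a).st.clock = a.st.clock := by
  rcases enterView_cases cfg a with ⟨h, -⟩ | ⟨-, ms, -, -, h, -⟩ <;> simp [h, Progress.moveTo]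

theorem enterView_out (cfg : Config) (a : Progress n Req) :
    ∀ x ∈ (enterView cfg a).out, x ∈ a.out ∨ ∃ T, x.2 = .request T := by
  intro x hx
  rcases enterView_cases cfg a with ⟨h, -⟩ | ⟨-, ms, -, -, -, -, Ts, h⟩
  · rw [h] at hx; exact Or.inl hx
  · rw [h, List.mem_append, List.mem_map] at hx
    rcases hx with hx | ⟨T, -, rfl⟩
    · exact Or.inl hx
    · exact Or.inr ⟨T, rfl⟩

/-! ### Supporting proposals -/

theorem supportProposals_shape (a : Progress n Req) :
    ∃ S o, supportProposals a =
      { a with st := { a.st with supported := a.st.supported ++ S }, out := a.out ++ o } ∧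
      (∀ x ∈ S, (primary n a.st.view, Msg.propose x.1 x.2.1 x.2.2) ∈ a.st.inbox ∧
        x.2.1 = a.st.view ∧ a.st.halted = false ∧
        (primary n a.st.view, Msg.support x.1 x.2.1 x.2.2) ∈ o) ∧
      (∀ x ∈ o, ∃ T k, x.2 = .support T a.st.view k ∧ a.st.halted = false) := by
  unfold supportProposals
  split
  · exact ⟨[], [], by simp, by simp, by simp⟩
  · rename_i hh
    have hh : a.st.halted = false := by simpa using hh
    refine List.foldlRecOn (motive := fun b : Progress n Req => ∃ S o, b =
      ({ a with st := { a.st with supported := a.st.supported ++ S }, out := a.out ++ o } :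
        Progress n Req) ∧
      (∀ x ∈ S, (primary n a.st.view, Msg.propose x.1 x.2.1 x.2.2) ∈ a.st.inbox ∧
        x.2.1 = a.st.view ∧ a.st.halted = false ∧
        (primary n a.st.view, Msg.support x.1 x.2.1 x.2.2) ∈ o) ∧
      (∀ x ∈ o, ∃ T k, x.2 = .support T a.st.view k ∧ a.st.halted = false)) _ _
      ⟨[], [], by simp, by simp, by simp⟩ ?_
    rintro b ⟨S, o, rfl, h1, h2⟩ ⟨q, m⟩ hx
    split
    · rename_i T v k hm
      simp only at hm
      subst hm
      split
      · rename_i hc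
        obtain ⟨c1, c2, c3, c4⟩ := hc
        simp only at c1 c2
        subst c1 c2
        refine ⟨S ++ [(T, a.st.view, k)], o ++ [(primary n a.st.view, .support T a.st.view k)],
          by simp [Progress.send], ?_, ?_⟩
        · intro x hx'
          rcases List.mem_append.1 hx' with h | h
          · obtain ⟨e1, e2, e3, e4⟩ := h1 x h
            exact ⟨e1, e2, e3, List.mem_append_left _ e4⟩
          · obtain rfl := List.mem_singleton.1 h
            exact ⟨hx, rfl, hh, by simp⟩
        · intro x hx'
          rcases List.mem_append.1 hx' with h | h
          · exact h2 x h
          · obtain rfl := List.mem_singleton.1 h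
            exact ⟨T, k, rfl, hh⟩
      · exact ⟨S, o, rfl, h1, h2⟩
    · exact ⟨S, o, rfl, h1, h2⟩

@[simp] theorem supportProposals_frame (a : Progress n Req) :
    (supportProposals a).st.view = a.st.view ∧ (supportProposals a).st.halted = a.st.halted ∧
    (supportProposals a).st.log = a.st.log ∧ (supportProposals a).st.known = a.st.known ∧
    (supportProposals a).st.inbox = a.st.inbox ∧ (supportProposals a).st.base = a.st.base ∧
    (supportProposals a).st.proposed = a.st.proposed ∧
    (supportProposals a).st.certified = a.st.certified ∧
    (supportProposals a).st.lastNewView = a.st.lastNewView ∧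
    (supportProposals a).st.timer = a.st.timer ∧
    (supportProposals a).st.checkpoints = a.st.checkpoints ∧
    (supportProposals a).st.clock = a.st.clock ∧ (supportProposals a).execs = a.execs := by
  obtain ⟨S, o, h, -⟩ := supportProposals_shape a
  simp [h]

/-! ### Executing transactions -/

theorem executeNext_cases (cfg : Config) (a : Progress n Req) :
    (executeNext cfg a = a ∧ ∀ p c, (p, Msg.certify c) ∈ a.st.inbox →
      viewCommits cfg a.st p c = true → c.seq ≠ a.st.log.length) ∨
    ∃ p c, (p, Msg.certify c) ∈ a.st.inbox ∧ viewCommits cfg a.st p c = true ∧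
      c.seq = a.st.log.length ∧ executeNext cfg a =
        { a with st := { a.st with log := a.st.log ++ [c] }, execs := a.execs ++ [c] } := by
  unfold executeNext
  split
  · rename_i h
    refine Or.inl ⟨rfl, fun p c hc h1 h2 => ?_⟩
    have := List.findSome?_eq_none_iff.1 h _ hc
    simp [h1, h2] at this
  · rename_i c h
    obtain ⟨⟨q, m⟩, hx, h⟩ := List.exists_of_findSome?_eq_some h
    cases m <;> simp at h
    obtain ⟨⟨h1, h2⟩, h4⟩ := h
    subst h4
    exact Or.inr ⟨_, _, hx, h1, h2, rfl⟩

theorem viewCommits_iff {cfg : Config} {s : State n Req} {p : Fin n} {c : Cert n Req} :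
    viewCommits cfg s p c = true ↔ (p = primary n c.view ∧ c.view = s.view ∧
      (c.req, c.view, c.seq) ∈ s.supported) ∧ c.valid cfg = true := by
  simp [viewCommits]

theorem execute_induction {cfg : Config} {a : Progress n Req} (P : Progress n Req → Prop)
    (h0 : P a) (hs : ∀ b, P b → a.st.halted = false → P (executeNext cfg b)) :
    P (execute cfg a) := by
  unfold execute
  split
  · exact h0
  · rename_i hh
    have hh : a.st.halted = false := by simpa using hh
    generalize a.st.inbox.length = N
    induction N with
    | zero => exact h0
    | succ N ih => rw [Function.iterate_succ_apply']; exact hs _ ih hh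

theorem execute_shape (cfg : Config) (a : Progress n Req) :
    ∃ l, execute cfg a =
      { a with st := { a.st with log := a.st.log ++ l }, execs := a.execs ++ l } ∧
      ∀ c ∈ l, a.st.halted = false ∧ ∃ p, viewCommits cfg a.st p c = true := by
  refine execute_induction (fun b => ∃ l, b =
      ({ a with st := { a.st with log := a.st.log ++ l }, execs := a.execs ++ l } :
        Progress n Req) ∧ ∀ c ∈ l, a.st.halted = false ∧ ∃ p, viewCommits cfg a.st p c = true)
    ⟨[], by simp, by simp⟩ ?_
  rintro b ⟨l, rfl, hl⟩ hh
  rcases executeNext_cases cfg ({ a with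
    st := { a.st with log := a.st.log ++ l }, execs := a.execs ++ l } : Progress n Req) with
    ⟨h, -⟩ | ⟨p, c, h1, h2, h3, h⟩
  · exact ⟨l, h, hl⟩
  · refine ⟨l ++ [c], by rw [h]; simp, ?_⟩
    intro c' hc'
    rcases List.mem_append.1 hc' with h | h
    · exact hl _ h
    · obtain rfl := List.mem_singleton.1 h
      refine ⟨hh, p, ?_⟩
      rw [viewCommits_iff] at h2 ⊢
      exact h2

@[simp] theorem execute_frame (cfg : Config) (a : Progress n Req) :
    (execute cfg a).st.view = a.st.view ∧ (execute cfg a).st.halted = a.st.halted ∧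
    (execute cfg a).st.known = a.st.known ∧ (execute cfg a).st.inbox = a.st.inbox ∧
    (execute cfg a).st.supported = a.st.supported ∧ (execute cfg a).st.base = a.st.base ∧
    (execute cfg a).st.proposed = a.st.proposed ∧ (execute cfg a).st.certified = a.st.certified ∧
    (execute cfg a).st.lastNewView = a.st.lastNewView ∧
    (execute cfg a).st.timer = a.st.timer ∧
    (execute cfg a).st.checkpoints = a.st.checkpoints ∧
    (execute cfg a).st.clock = a.st.clock ∧ (execute cfg a).out = a.out := by
  obtain ⟨l, h, -⟩ := execute_shape cfg a
  simp [h]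

/-! ### Proposing requests -/

theorem proposeRequests_shape (me : Fin n) (a : Progress n Req) :
    ∃ l o, proposeRequests me a =
      { a with st := { a.st with proposed := a.st.proposed ++ l }, out := a.out ++ o } ∧
      (∀ i T, l[i]? = some T → ∀ r,
        (r, Msg.propose T a.st.view (a.st.base + (a.st.proposed.length + i))) ∈ o) ∧
      (∀ x ∈ o, a.st.halted = false ∧ me = primary n a.st.view ∧ ∃ i T, l[i]? = some T ∧
        x.2 = .propose T a.st.view (a.st.base + (a.st.proposed.length + i))) := by
  unfold proposeRequests
  split
  · rename_i hh
    have hh : a.st.halted = false ∧ me = primary n a.st.view := by simpa using hh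
    refine List.foldlRecOn (motive := fun b : Progress n Req => ∃ l o, b =
      ({ a with st := { a.st with proposed := a.st.proposed ++ l }, out := a.out ++ o } :
        Progress n Req) ∧
      (∀ i T, l[i]? = some T → ∀ r,
        (r, Msg.propose T a.st.view (a.st.base + (a.st.proposed.length + i))) ∈ o) ∧
      (∀ x ∈ o, a.st.halted = false ∧ me = primary n a.st.view ∧ ∃ i T, l[i]? = some T ∧
        x.2 = .propose T a.st.view (a.st.base + (a.st.proposed.length + i)))) _ _
      ⟨[], [], by simp, by simp, by simp⟩ ?_
    rintro b ⟨l, o, rfl, h1, h2⟩ T -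
    split
    · refine ⟨l ++ [T], o ++ broadcast (.propose T a.st.view
        (a.st.base + (a.st.proposed.length + l.length))), by simp [Progress.send], ?_, ?_⟩
      · intro i T' hi r
        rcases lt_or_ge i l.length with h | h
        · rw [List.getElem?_append_left h] at hi
          exact List.mem_append_left _ (h1 i T' hi r)
        · rw [List.getElem?_append_right h] at hi
          obtain ⟨h3, h4⟩ := List.getElem?_eq_some_iff.1 hi
          simp only [List.length_singleton] at h3
          obtain rfl : i = l.length := by omega
          simp only [Nat.sub_self, List.getElem_cons_zero] at h4
          subst h4
          exact List.mem_append_right _ (mem_broadcast.2 rfl)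
      · intro x hx
        rcases List.mem_append.1 hx with h | h
        · obtain ⟨e1, e2, i, T', e3, e4⟩ := h2 x h
          refine ⟨e1, e2, i, T', ?_, e4⟩
          rw [List.getElem?_append_left (List.getElem?_eq_some_iff.1 e3).1, e3]
        · exact ⟨hh.1, hh.2, l.length, T, by simp, mem_broadcast.1 h⟩
    · exact ⟨l, o, rfl, h1, h2⟩
  · exact ⟨[], [], by simp, by simp, by simp⟩

@[simp] theorem proposeRequests_frame (me : Fin n) (a : Progress n Req) :
    (proposeRequests me a).st.view = a.st.view ∧
    (proposeRequests me a).st.halted = a.st.halted ∧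
    (proposeRequests me a).st.log = a.st.log ∧ (proposeRequests me a).st.known = a.st.known ∧
    (proposeRequests me a).st.inbox = a.st.inbox ∧
    (proposeRequests me a).st.supported = a.st.supported ∧
    (proposeRequests me a).st.base = a.st.base ∧
    (proposeRequests me a).st.certified = a.st.certified ∧
    (proposeRequests me a).st.lastNewView = a.st.lastNewView ∧
    (proposeRequests me a).st.timer = a.st.timer ∧
    (proposeRequests me a).st.checkpoints = a.st.checkpoints ∧
    (proposeRequests me a).st.clock = a.st.clock ∧ (proposeRequests me a).execs = a.execs := by
  obtain ⟨S, o, h, -⟩ := proposeRequests_shape me a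
  simp [h]

/-- The fold changes neither the log nor the known requests, so `T` stays pending and is appended
when the fold reaches it, unless it is already listed. -/
theorem mem_proposeRequests {me : Fin n} {a : Progress n Req} (hh : a.st.halted = false)
    (hp : me = primary n a.st.view) {T : Req} (hk : T ∈ a.st.known)
    (hT : a.st.pending T = true) : T ∈ (proposeRequests me a).st.proposed := by
  unfold proposeRequests
  rw [if_pos ⟨by simp [hh], hp⟩]
  suffices H : ∀ (l : List Req) (b : Progress n Req), b.st.pending T = true →
      T ∈ l ∨ T ∈ b.st.proposed → T ∈ (l.foldl (fun b T =>
        if b.st.pending T ∧ T ∉ b.st.proposed then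
          ({ b with st := { b.st with proposed := b.st.proposed ++ [T] } } : Progress n Req).send
            (broadcast (.propose T b.st.view (b.st.base + b.st.proposed.length)))
        else b) b).st.proposed from H _ _ hT (Or.inl hk)
  intro l
  induction l with
  | nil => intro b _ h; simpa using h
  | cons T' l ih =>
    intro b hb h
    rw [List.foldl_cons]
    apply ih
    · split
      · exact hb
      · exact hb
    · by_cases hTT : T' = T
      · right
        subst hTT
        split
        · simp
        · rename_i h'
          simpa [hb] using h'
      · rcases h with h | h
        · left
          rcases List.mem_cons.1 h with h | h
          · exact absurd h.symm hTT
          · exact h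
        · right
          split
          · simp [h]
          · exact h

/-! ### Certifying proposals -/

theorem certifyProposals_shape (cfg : Config) (me : Fin n) (a : Progress n Req) :
    ∃ l o, certifyProposals cfg me a =
      { a with st := { a.st with certified := a.st.certified ++ l }, out := a.out ++ o } ∧
      (∀ k ∈ l, ∃ i T S, k = a.st.base + i ∧ a.st.proposed[i]? = some T ∧ cfg.nf n ≤ S.card ∧
        ∀ r, (r, Msg.certify ⟨T, a.st.view, k, S⟩) ∈ o) ∧
      (∀ x ∈ o, ∃ c, x.2 = .certify c) := by
  unfold certifyProposals
  split
  · refine List.foldlRecOn (motive := fun b : Progress n Req => ∃ l o, b =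
      ({ a with st := { a.st with certified := a.st.certified ++ l }, out := a.out ++ o } :
        Progress n Req) ∧
      (∀ k ∈ l, ∃ i T S, k = a.st.base + i ∧ a.st.proposed[i]? = some T ∧ cfg.nf n ≤ S.card ∧
        ∀ r, (r, Msg.certify ⟨T, a.st.view, k, S⟩) ∈ o) ∧
      (∀ x ∈ o, ∃ c, x.2 = .certify c)) _ _ ?_ ?_
    · exact ⟨[], [], by simp, by simp, by simp⟩
    rintro b ⟨l, o, rfl, h1, h2⟩ ⟨T, i⟩ hx
    dsimp only
    split
    · rename_i hc
      refine ⟨l ++ [a.st.base + i], o ++ broadcast (.certify ⟨T, a.st.view, a.st.base + i, _⟩),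
        by simp [Progress.send]; rfl, ?_, ?_⟩
      · intro k hk
        rcases List.mem_append.1 hk with h | h
        · obtain ⟨i, T, S, e1, e2, e3, e4⟩ := h1 k h
          exact ⟨i, T, S, e1, e2, e3, fun r => List.mem_append_left _ (e4 r)⟩
        · obtain rfl := List.mem_singleton.1 h
          exact ⟨i, T, _, rfl, List.mem_zipIdx_iff_getElem?.1 hx, hc.2,
            fun r => List.mem_append_right _ (mem_broadcast.2 rfl)⟩
      · intro x hx
        rcases List.mem_append.1 hx with h | h
        · exact h2 x h
        · exact ⟨_, mem_broadcast.1 h⟩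
    · exact ⟨l, o, rfl, h1, h2⟩
  · exact ⟨[], [], by simp, by simp, by simp⟩

@[simp] theorem certifyProposals_frame (cfg : Config) (me : Fin n) (a : Progress n Req) :
    (certifyProposals cfg me a).st.view = a.st.view ∧
    (certifyProposals cfg me a).st.halted = a.st.halted ∧
    (certifyProposals cfg me a).st.log = a.st.log ∧
    (certifyProposals cfg me a).st.known = a.st.known ∧
    (certifyProposals cfg me a).st.inbox = a.st.inbox ∧
    (certifyProposals cfg me a).st.supported = a.st.supported ∧
    (certifyProposals cfg me a).st.base = a.st.base ∧
    (certifyProposals cfg me a).st.proposed = a.st.proposed ∧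
    (certifyProposals cfg me a).st.lastNewView = a.st.lastNewView ∧
    (certifyProposals cfg me a).st.timer = a.st.timer ∧
    (certifyProposals cfg me a).st.checkpoints = a.st.checkpoints ∧
    (certifyProposals cfg me a).st.clock = a.st.clock ∧
    (certifyProposals cfg me a).execs = a.execs := by
  obtain ⟨S, o, h, -⟩ := certifyProposals_shape cfg me a
  simp [h]

/-- Certifying changes neither the inbox nor the base, so the set of supporters of a slot is the
same at every step of the fold. -/
theorem mem_certifyProposals {cfg : Config} {me : Fin n} {a : Progress n Req}
    (hh : a.st.halted = false) (hp : me = primary n a.st.view) {T : Req} {i : ℕ}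
    (hi : a.st.proposed[i]? = some T)
    (hS : cfg.nf n ≤ (supporters a.st T a.st.view (a.st.base + i)).card) :
    a.st.base + i ∈ (certifyProposals cfg me a).st.certified := by
  unfold certifyProposals
  rw [if_pos ⟨by simp [hh], hp⟩]
  suffices H : ∀ (l : List (Req × ℕ)) (b : Progress n Req),
      cfg.nf n ≤ (supporters b.st T b.st.view (b.st.base + i)).card → b.st.base = a.st.base →
      (T, i) ∈ l ∨ a.st.base + i ∈ b.st.certified → a.st.base + i ∈ (l.foldl (fun b x =>
        let k := b.st.base + x.2
        let S := supporters b.st x.1 b.st.view k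
        if k ∉ b.st.certified ∧ cfg.nf n ≤ S.card then
          ({ b with st := { b.st with certified := b.st.certified ++ [k] } } :
            Progress n Req).send (broadcast (.certify ⟨x.1, b.st.view, k, S⟩))
        else b) b).st.certified from
    H _ _ hS rfl (Or.inl (List.mem_zipIdx_iff_getElem?.2 hi))
  intro l
  induction l with
  | nil => intro b _ _ h; simpa using h
  | cons x l ih =>
    intro b hb hbase h
    rw [List.foldl_cons]
    dsimp only
    apply ih
    · split
      · exact hb
      · exact hb
    · split
      · exact hbase
      · exact hbase
    · by_cases hx : x = (T, i)
      · right
        subst hx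
        split
        · simp [hbase]
        · rename_i h'
          rw [← hbase]
          by_contra hcon
          exact h' ⟨hcon, hb⟩
      · rcases h with h | h
        · left
          rcases List.mem_cons.1 h with h | h
          · exact absurd h.symm hx
          · exact h
        · right
          split
          · simp [h]
          · exact h

/-! ### View-changes -/

@[simp] theorem advanceTimers_frame (a : Progress n Req) :
    (advanceTimers a).st.view = a.st.view ∧ (advanceTimers a).st.halted = a.st.halted ∧
    (advanceTimers a).st.log = a.st.log ∧ (advanceTimers a).st.known = a.st.known ∧
    (advanceTimers a).st.inbox = a.st.inbox ∧
    (advanceTimers a).st.supported = a.st.supported ∧ (advanceTimers a).st.base = a.st.base ∧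
    (advanceTimers a).st.proposed = a.st.proposed ∧
    (advanceTimers a).st.certified = a.st.certified ∧
    (advanceTimers a).st.lastNewView = a.st.lastNewView ∧
    (advanceTimers a).st.checkpoints = a.st.checkpoints ∧
    (advanceTimers a).st.clock = a.st.clock ∧ (advanceTimers a).execs = a.execs ∧
    (advanceTimers a).out = a.out := by
  simp [advanceTimers]

theorem advanceTimers_timer (a : Progress n Req) (T : Req) :
    (advanceTimers a).st.timer T = if a.st.pending T then a.st.timer T + 1 else 0 := rfl

/-- Some request is waiting for longer than the timeout. -/
def State.Expired (cfg : Config) (s : State n Req) : Prop :=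
  ∃ T ∈ s.known, s.pending T = true ∧ s.timeout cfg ≤ s.timer T

theorem detectFailure_cases (cfg : Config) (me : Fin n) (a : Progress n Req) :
    (a.st.Expired cfg ∧ detectFailure cfg me a =
      requestViewChange me (if a.st.halted then a.st.view + 1 else a.st.view) a) ∨
    (a.st.halted = false ∧ cfg.f + 1 ≤ (complainers a.st a.st.view).card ∧
      detectFailure cfg me a = requestViewChange me a.st.view a) ∨
    (¬ a.st.Expired cfg ∧ detectFailure cfg me a = a) := by
  unfold detectFailure
  dsimp only
  split
  · rename_i h
    exact Or.inl ⟨by simpa [State.Expired] using h, rfl⟩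
  · rename_i h
    have h : ¬ a.st.Expired cfg := by simpa [State.Expired] using h
    split
    · rename_i h2
      exact Or.inr (Or.inl ⟨by simpa using h2.1, h2.2, rfl⟩)
    · exact Or.inr (Or.inr ⟨h, rfl⟩)

@[simp] theorem detectFailure_frame (cfg : Config) (me : Fin n) (a : Progress n Req) :
    (detectFailure cfg me a).st.log = a.st.log ∧ (detectFailure cfg me a).st.known = a.st.known ∧
    (detectFailure cfg me a).st.inbox = a.st.inbox ∧
    (detectFailure cfg me a).st.supported = a.st.supported ∧
    (detectFailure cfg me a).st.base = a.st.base ∧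
    (detectFailure cfg me a).st.proposed = a.st.proposed ∧
    (detectFailure cfg me a).st.certified = a.st.certified ∧
    (detectFailure cfg me a).st.lastNewView = a.st.lastNewView ∧
    (detectFailure cfg me a).st.checkpoints = a.st.checkpoints ∧
    (detectFailure cfg me a).st.clock = a.st.clock ∧
    (detectFailure cfg me a).execs = a.execs := by
  rcases detectFailure_cases cfg me a with ⟨-, h⟩ | ⟨-, -, h⟩ | ⟨-, h⟩ <;>
    simp [h, requestViewChange]

theorem detectFailure_out (cfg : Config) (me : Fin n) (a : Progress n Req) :
    a.out ⊆ (detectFailure cfg me a).out ∧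
    ∀ x ∈ (detectFailure cfg me a).out, x ∈ a.out ∨ (x.2 =
      .vcRequest ⟨me, (detectFailure cfg me a).st.view, a.st.log⟩ ∧
        (detectFailure cfg me a).st.halted = true) := by
  rcases detectFailure_cases cfg me a with ⟨-, h⟩ | ⟨-, -, h⟩ | ⟨-, h⟩
  · rw [h]
    simp +contextual [requestViewChange, mem_broadcast]
  · rw [h]
    simp +contextual [requestViewChange, mem_broadcast]
  · rw [h]
    simp +contextual

theorem proposeView_cases (cfg : Config) (me : Fin n) (a : Progress n Req) :
    (proposeView cfg me a = a ∧ (me = primary n (a.st.view + 1) →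
      a.st.lastNewView < a.st.view + 1 →
      ((List.finRange n).filterMap (firstVcRequest cfg a.st a.st.view)).length < cfg.nf n)) ∨
    (me = primary n (a.st.view + 1) ∧ a.st.lastNewView < a.st.view + 1 ∧ ∃ ms,
      validNewView cfg (a.st.view + 1) ms = true ∧ proposeView cfg me a =
        { a with st := { a.st with lastNewView := a.st.view + 1 },
                 out := a.out ++ broadcast (.nvPropose (a.st.view + 1) ms) }) := by
  unfold proposeView
  dsimp only
  split
  · rename_i h
    obtain ⟨h1, h2, h3⟩ := h
    refine Or.inr ⟨h1, h2, _, ?_, rfl⟩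
    have key : ∀ p m, firstVcRequest cfg a.st a.st.view p = some m →
        m.sender = p ∧ m.view = a.st.view ∧ validLog cfg m.log = true := by
      intro p m hm
      obtain ⟨⟨q, m'⟩, hx, h⟩ := List.exists_of_findSome?_eq_some hm
      cases m' <;> simp at h
      obtain ⟨⟨h1, h2, h3⟩, h4⟩ := h
      subst h4
      exact ⟨h1, h2, h3⟩
    -- Each identifier is tried once and yields at most one request, signed by itself; hence the
    -- senders are distinct.
    have hnd : ((((List.finRange n).filterMap (firstVcRequest cfg a.st a.st.view))).map
        VcRequest.sender).Nodup := by
      rw [List.map_filterMap]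
      refine List.Nodup.filterMap ?_ (List.nodup_finRange n)
      intro p p' q hq hq'
      simp only [Option.mem_def, Option.map_eq_some_iff] at hq hq'
      obtain ⟨m, hm, rfl⟩ := hq
      obtain ⟨m', hm', h⟩ := hq'
      rw [← (key _ _ hm).1, ← (key _ _ hm').1, h]
    simp only [validNewView, Bool.and_eq_true, decide_eq_true_eq, List.all_eq_true]
    refine ⟨⟨?_, ?_⟩, ?_⟩
    · rw [List.map_take]
      exact hnd.sublist (List.take_sublist _ _)
    · rw [List.length_take, min_eq_left h3]
    · intro m hm
      obtain ⟨p, -, hp⟩ := List.mem_filterMap.1 (List.mem_of_mem_take hm)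
      obtain ⟨-, e2, e3⟩ := key _ _ hp
      exact ⟨by rw [e2], e3⟩
  · rename_i h
    refine Or.inl ⟨rfl, fun h1 h2 => ?_⟩
    by_contra h3
    exact h ⟨h1, h2, by simpa using h3⟩

@[simp] theorem proposeView_frame (cfg : Config) (me : Fin n) (a : Progress n Req) :
    (proposeView cfg me a).st.view = a.st.view ∧
    (proposeView cfg me a).st.halted = a.st.halted ∧
    (proposeView cfg me a).st.log = a.st.log ∧ (proposeView cfg me a).st.known = a.st.known ∧
    (proposeView cfg me a).st.inbox = a.st.inbox ∧
    (proposeView cfg me a).st.supported = a.st.supported ∧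
    (proposeView cfg me a).st.base = a.st.base ∧
    (proposeView cfg me a).st.proposed = a.st.proposed ∧
    (proposeView cfg me a).st.certified = a.st.certified ∧
    (proposeView cfg me a).st.timer = a.st.timer ∧
    (proposeView cfg me a).st.checkpoints = a.st.checkpoints ∧
    (proposeView cfg me a).st.clock = a.st.clock ∧
    (proposeView cfg me a).execs = a.execs := by
  rcases proposeView_cases cfg me a with ⟨h, -⟩ | ⟨-, -, ms, -, h⟩ <;> simp [h]

@[simp] theorem sendCheckpoint_frame (cfg : Config) (old : List (Cert n Req))
    (a : Progress n Req) :
    (sendCheckpoint cfg old a).st = a.st ∧ (sendCheckpoint cfg old a).execs = a.execs := by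
  unfold sendCheckpoint
  split <;> simp

theorem sendCheckpoint_out (cfg : Config) (old : List (Cert n Req)) (a : Progress n Req) :
    a.out ⊆ (sendCheckpoint cfg old a).out ∧
    ∀ x ∈ (sendCheckpoint cfg old a).out, x ∈ a.out ∨ ∃ E, x.2 = .checkpoint E := by
  unfold sendCheckpoint
  split
  · refine ⟨by simp, fun x hx => ?_⟩
    rcases List.mem_append.1 hx with h | h
    · exact Or.inl h
    · exact Or.inr ⟨_, mem_broadcast.1 h⟩
  · simp +contextual

end Frames


/-! ### The tick as a whole: its phases, its messages, its effect on the level -/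

section Ticks

variable {n : ℕ} [NeZero n] {Req : Type*} [DecidableEq Req]

theorem exists_mem_supportProposals {a : Progress n Req} (hh : a.st.halted = false) {T : Req}
    {v k : ℕ} (hx : (primary n v, Msg.propose T v k) ∈ a.st.inbox) (hv : v = a.st.view)
    (hk : a.st.base ≤ k) : ∃ T', (T', v, k) ∈ (supportProposals a).st.supported := by
  unfold supportProposals
  rw [if_neg (by simp [hh])]
  suffices H : ∀ (l : List (Fin n × Msg n Req)) (b : Progress n Req), b.st.view = v →
      b.st.base ≤ k → (primary n v, Msg.propose T v k) ∈ l ∨ (∃ T', (T', v, k) ∈ b.st.supported) →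
      ∃ T', (T', v, k) ∈ (l.foldl (fun b x => match x.2 with
      | .propose T v k =>
          if x.1 = primary n v ∧ v = b.st.view ∧ b.st.base ≤ k ∧
              ∀ y ∈ b.st.supported, y.2 ≠ (v, k) then
            ({ b with st := { b.st with supported := b.st.supported ++ [(T, v, k)] } }
              : Progress n Req).send [(primary n v, .support T v k)]
          else b
      | _ => b) b).st.supported from H _ _ hv.symm hk (Or.inl hx)
  intro l
  induction l with
  | nil => intro b _ _ h; simpa using h
  | cons x l ih =>
    intro b hb hk h
    rw [List.foldl_cons]
    apply ih
    · split
      · split <;> exact hb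
      · exact hb
    · split
      · split <;> exact hk
      · exact hk
    · by_cases hx : x = (primary n v, Msg.propose T v k)
      · right
        subst hx
        dsimp only
        split
        · exact ⟨T, by simp⟩
        · rename_i h'
          by_contra hcon
          refine h' ⟨rfl, hb.symm, hk, ?_⟩
          rintro ⟨T', y⟩ hy rfl
          exact hcon ⟨T', hy⟩
      · rcases h with h | ⟨T', h⟩
        · left
          rcases List.mem_cons.1 h with h | h
          · exact absurd h.symm hx
          · exact h
        · right
          refine ⟨T', ?_⟩
          split
          · split
            · simp [h]
            · exact h
          · exact h

/-- After the execution rules have run, no view-committed transaction is next in order. -/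
theorem execute_exhaustive {cfg : Config} {a : Progress n Req} (hh : a.st.halted = false)
    {p : Fin n} {c : Cert n Req} (hc : (p, Msg.certify c) ∈ a.st.inbox)
    (hv : viewCommits cfg a.st p c = true) : c.seq ≠ (execute cfg a).st.log.length := by
  classical
  -- The sequence numbers of received certificates. There are at most `inbox.length` of them, which
  -- is why `inbox.length` iterations suffice.
  set seqs : Finset ℕ := (a.st.inbox.filterMap (fun x => match x.2 with
    | .certify c => some c.seq
    | _ => none)).toFinset with hseqs
  have mem_seqs : ∀ q c, (q, Msg.certify c) ∈ a.st.inbox → c.seq ∈ seqs := by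
    intro q c h
    rw [hseqs, List.mem_toFinset, List.mem_filterMap]
    exact ⟨_, h, rfl⟩
  have hcard : seqs.card ≤ a.st.inbox.length :=
    (List.toFinset_card_le _).trans (List.length_filterMap_le _ _)
  -- After `N` iterations, either the loop is stuck (and `c` is not next), or all `N` of them
  -- executed something, and the sequence numbers used are `N` consecutive elements of `seqs`.
  have key : ∀ N, ((executeNext cfg)^[N] a).st.inbox = a.st.inbox ∧
      (∀ q c, viewCommits cfg ((executeNext cfg)^[N] a).st q c = viewCommits cfg a.st q c) ∧
      (c.seq ≠ ((executeNext cfg)^[N] a).st.log.length ∧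
          executeNext cfg ((executeNext cfg)^[N] a) = (executeNext cfg)^[N] a ∨
        ((executeNext cfg)^[N] a).st.log.length = a.st.log.length + N ∧
          Finset.Ico a.st.log.length (a.st.log.length + N) ⊆ seqs) := by
    intro N
    induction N with
    | zero => exact ⟨rfl, fun _ _ => rfl, Or.inr ⟨rfl, by simp⟩⟩
    | succ N ih =>
      rw [Function.iterate_succ_apply']
      generalize (executeNext cfg)^[N] a = b at ih ⊢
      obtain ⟨ih1, ih2, ih3⟩ := ih
      rcases executeNext_cases cfg b with ⟨h, h'⟩ | ⟨q, c', h1, h2, h3, h⟩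
      · rw [h]
        refine ⟨ih1, ih2, Or.inl ⟨h' p c (ih1 ▸ hc) (by rw [ih2, hv]), h⟩⟩
      · have hne : executeNext cfg b ≠ b := by
          rw [h]
          intro h5
          have := congrArg (fun b => b.st.log.length) h5
          simp at this
        rcases ih3 with ⟨-, h5⟩ | ⟨h5, h6⟩
        · exact absurd h5 hne
        · rw [h]
          refine ⟨ih1, ih2, Or.inr ⟨by simp [h5]; omega, ?_⟩⟩
          intro k hk
          rw [Finset.mem_Ico] at hk
          by_cases hk' : k < a.st.log.length + N
          · exact h6 (Finset.mem_Ico.2 ⟨hk.1, hk'⟩)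
          · have : k = c'.seq := by omega
            rw [this]
            exact mem_seqs _ _ (ih1 ▸ h1)
  unfold execute
  rw [if_neg (by simp [hh])]
  obtain ⟨-, -, h | ⟨h1, h2⟩⟩ := key a.st.inbox.length
  · exact h.1
  · intro h3
    -- Pigeonhole: if no iteration was idle and `c` were still next, `seqs` would have more than
    -- `inbox.length` elements.
    have h4 : Finset.Ico a.st.log.length (a.st.log.length + a.st.inbox.length + 1) ⊆ seqs := by
      intro k hk
      rw [Finset.mem_Ico] at hk
      by_cases hk' : k < a.st.log.length + a.st.inbox.length
      · exact h2 (Finset.mem_Ico.2 ⟨hk.1, hk'⟩)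
      · have : k = c.seq := by omega
        rw [this]
        exact mem_seqs _ _ hc
    have := Finset.card_le_card h4
    rw [Nat.card_Ico] at this
    omega

/-! ### The parts of a tick -/

/-- The progress in a tick after recovery and, possibly, entering the next view. -/
def entered (cfg : Config) (s : State n Req) (reqs : List Req) (ms : List (Fin n × Msg n Req)) :
    Progress n Req :=
  enterView cfg (catchUp (receive cfg reqs ms ⟨s, [], []⟩))

/-- The rules of the normal case. -/
def normalCase (cfg : Config) (me : Fin n) (a : Progress n Req) : Progress n Req :=
  certifyProposals cfg me (proposeRequests me (execute cfg (supportProposals a)))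

/-- The cut is made where the view can change: it changes only inside `entered` and in
`detectFailure`, so all normal-case rules of a tick refer to the view of `entered`. -/
theorem tick_eq (cfg : Config) (me : Fin n) (s : State n Req) (reqs : List Req)
    (ms : List (Fin n × Msg n Req)) : tick cfg me s reqs ms =
      sendCheckpoint cfg s.log (proposeView cfg me (detectFailure cfg me
        (advanceTimers (normalCase cfg me (entered cfg s reqs ms))))) := rfl

@[simp] theorem normalCase_frame (cfg : Config) (me : Fin n) (a : Progress n Req) :
    (normalCase cfg me a).st.view = a.st.view ∧
    (normalCase cfg me a).st.halted = a.st.halted ∧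
    (normalCase cfg me a).st.log = (execute cfg (supportProposals a)).st.log ∧
    (normalCase cfg me a).st.known = a.st.known ∧
    (normalCase cfg me a).st.inbox = a.st.inbox ∧
    (normalCase cfg me a).st.supported = (supportProposals a).st.supported ∧
    (normalCase cfg me a).st.base = a.st.base ∧
    (normalCase cfg me a).st.proposed =
      (proposeRequests me (execute cfg (supportProposals a))).st.proposed ∧
    (normalCase cfg me a).st.lastNewView = a.st.lastNewView ∧
    (normalCase cfg me a).st.timer = a.st.timer ∧
    (normalCase cfg me a).st.checkpoints = a.st.checkpoints ∧
    (normalCase cfg me a).st.clock = a.st.clock ∧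
    (normalCase cfg me a).execs = (execute cfg (supportProposals a)).execs := by
  simp [normalCase]

@[simp] theorem entered_frame (cfg : Config) (s : State n Req) (reqs : List Req)
    (ms : List (Fin n × Msg n Req)) :
    (entered cfg s reqs ms).st.inbox = s.inbox ++ ms ∧
    (entered cfg s reqs ms).st.supported = s.supported ∧
    (entered cfg s reqs ms).st.lastNewView = s.lastNewView ∧
    (entered cfg s reqs ms).st.timer = s.timer ∧
    (entered cfg s reqs ms).st.clock = s.clock + 1 := by
  simp [entered]

theorem known_subset_entered (cfg : Config) (s : State n Req) (reqs : List Req)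
    (ms : List (Fin n × Msg n Req)) : s.known ⊆ (entered cfg s reqs ms).st.known := by
  simpa [entered] using known_subset_receive cfg reqs ms ⟨s, [], []⟩

theorem entered_cases (cfg : Config) (s : State n Req) (reqs : List Req)
    (ms : List (Fin n × Msg n Req)) :
    ((entered cfg s reqs ms).st.view = s.view ∧ (entered cfg s reqs ms).st.halted = s.halted ∧
      (entered cfg s reqs ms).st.base = s.base ∧
      (entered cfg s reqs ms).st.proposed = s.proposed ∧
      (entered cfg s reqs ms).st.certified = s.certified ∧
      (s.halted = false → (entered cfg s reqs ms).st.log = s.log) ∧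
      (s.halted = true → ∀ vs,
        (primary n (s.view + 1), Msg.nvPropose (s.view + 1) vs) ∈ s.inbox ++ ms →
          validNewView cfg (s.view + 1) vs = false)) ∨
    (s.halted = true ∧ ∃ vs,
      (primary n (s.view + 1), Msg.nvPropose (s.view + 1) vs) ∈ s.inbox ++ ms ∧
      validNewView cfg (s.view + 1) vs = true ∧
      (entered cfg s reqs ms).st.view = s.view + 1 ∧
      (entered cfg s reqs ms).st.halted = false ∧
      (entered cfg s reqs ms).st.base = (longestLog vs).length ∧
      (entered cfg s reqs ms).st.log = longestLog vs ∧
      (entered cfg s reqs ms).st.proposed = [] ∧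
      (entered cfg s reqs ms).st.certified = []) := by
  unfold entered
  rcases enterView_cases cfg (catchUp (receive cfg reqs ms ⟨s, [], []⟩)) with
    ⟨h, h'⟩ | ⟨hh, vs, h1, h2, h3, -⟩
  · left
    rw [h]
    simp only [catchUp_frame, receive_frame] at h' ⊢
    refine ⟨trivial, trivial, trivial, trivial, trivial, fun hh => ?_, h'⟩
    rw [catchUp_of_not_halted (by simpa using hh)]
    simp
  · right
    rw [h3]
    simp only [catchUp_frame, receive_frame] at hh h1 h2 ⊢
    exact ⟨hh, vs, h1, h2, trivial, trivial, rfl, rfl, trivial, trivial⟩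

@[simp] theorem tick_frame (cfg : Config) (me : Fin n) (s : State n Req) (reqs : List Req)
    (ms : List (Fin n × Msg n Req)) :
    (tick cfg me s reqs ms).st.log =
      (execute cfg (supportProposals (entered cfg s reqs ms))).st.log ∧
    (tick cfg me s reqs ms).st.known = (entered cfg s reqs ms).st.known ∧
    (tick cfg me s reqs ms).st.inbox = s.inbox ++ ms ∧
    (tick cfg me s reqs ms).st.supported =
      (supportProposals (entered cfg s reqs ms)).st.supported ∧
    (tick cfg me s reqs ms).st.base = (entered cfg s reqs ms).st.base ∧
    (tick cfg me s reqs ms).st.proposed = (proposeRequests me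
      (execute cfg (supportProposals (entered cfg s reqs ms)))).st.proposed ∧
    (tick cfg me s reqs ms).st.certified =
      (normalCase cfg me (entered cfg s reqs ms)).st.certified ∧
    (tick cfg me s reqs ms).st.checkpoints = (entered cfg s reqs ms).st.checkpoints ∧
    (tick cfg me s reqs ms).st.clock = s.clock + 1 ∧
    (tick cfg me s reqs ms).execs =
      (execute cfg (supportProposals (entered cfg s reqs ms))).execs := by
  simp [tick_eq]

theorem known_subset_tick (cfg : Config) (me : Fin n) (s : State n Req) (reqs : List Req)
    (ms : List (Fin n × Msg n Req)) : s.known ⊆ (tick cfg me s reqs ms).st.known := by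
  simpa using known_subset_entered cfg s reqs ms

/-! ### Messages sent in a tick -/

theorem entered_out (cfg : Config) (s : State n Req) (reqs : List Req)
    (ms : List (Fin n × Msg n Req)) :
    ∀ x ∈ (entered cfg s reqs ms).out, ∃ T, x.2 = .request T := by
  intro x hx
  rcases enterView_out _ _ x hx with h | h
  · simp only [catchUp_frame] at h
    rcases receive_out _ _ _ _ x h with h | h
    · simp at h
    · exact h
  · exact h

theorem subset_proposeView_out (cfg : Config) (me : Fin n) (a : Progress n Req) :
    a.out ⊆ (proposeView cfg me a).out := by
  rcases proposeView_cases cfg me a with ⟨h, -⟩ | ⟨-, -, ms, -, h⟩ <;> simp [h]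

theorem normalCase_out_subset_tick (cfg : Config) (me : Fin n) (s : State n Req)
    (reqs : List Req) (ms : List (Fin n × Msg n Req)) :
    (normalCase cfg me (entered cfg s reqs ms)).out ⊆ (tick cfg me s reqs ms).out := by
  rw [tick_eq]
  refine List.Subset.trans ?_ (List.Subset.trans (subset_proposeView_out cfg me _)
    (sendCheckpoint_out cfg s.log _).1)
  exact List.Subset.trans (by simp) (detectFailure_out cfg me _).1

theorem supportProposals_out_subset_normalCase (cfg : Config) (me : Fin n)
    (a : Progress n Req) : (supportProposals a).out ⊆ (normalCase cfg me a).out := by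
  unfold normalCase
  obtain ⟨l, o, h, -⟩ := certifyProposals_shape cfg me
    (proposeRequests me (execute cfg (supportProposals a)))
  obtain ⟨l', o', h', -⟩ := proposeRequests_shape me (execute cfg (supportProposals a))
  rw [h, h']
  simp

theorem proposeRequests_out_subset_normalCase (cfg : Config) (me : Fin n)
    (a : Progress n Req) : (proposeRequests me (execute cfg (supportProposals a))).out ⊆
      (normalCase cfg me a).out := by
  unfold normalCase
  obtain ⟨l, o, h, -⟩ := certifyProposals_shape cfg me
    (proposeRequests me (execute cfg (supportProposals a)))
  rw [h]
  simp

/-- The messages sent in a tick, by their kinds. -/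
theorem tick_out (cfg : Config) (me : Fin n) (s : State n Req) (reqs : List Req)
    (ms : List (Fin n × Msg n Req)) (x : Fin n × Msg n Req)
    (hx : x ∈ (tick cfg me s reqs ms).out) :
    (((∃ T, x.2 = .request T) ∨
    (∃ T k, x.2 = .support T (entered cfg s reqs ms).st.view k ∧
      (entered cfg s reqs ms).st.halted = false) ∨
    ((entered cfg s reqs ms).st.halted = false ∧ me = primary n (entered cfg s reqs ms).st.view ∧
      ∃ i T, (tick cfg me s reqs ms).st.proposed[i]? = some T ∧ x.2 = .propose T
        (entered cfg s reqs ms).st.view ((tick cfg me s reqs ms).st.base + i)) ∨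
    (∃ c, x.2 = .certify c)) ∨
    (∃ E, x.2 = .vcRequest ⟨me, (tick cfg me s reqs ms).st.view, E⟩ ∧
      (tick cfg me s reqs ms).st.halted = true)) ∨
    (me = primary n ((tick cfg me s reqs ms).st.view + 1) ∧
      s.lastNewView < (tick cfg me s reqs ms).st.view + 1 ∧
      (tick cfg me s reqs ms).st.lastNewView = (tick cfg me s reqs ms).st.view + 1 ∧ ∃ vs,
        x.2 = .nvPropose ((tick cfg me s reqs ms).st.view + 1) vs ∧
        validNewView cfg ((tick cfg me s reqs ms).st.view + 1) vs = true ∧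
        ∀ y ∈ (tick cfg me s reqs ms).out, ∀ v' vs', y.2 = .nvPropose v' vs' → vs' = vs) ∨
    (∃ E, x.2 = .checkpoint E) := by
  have hnormal : ∀ y ∈ (normalCase cfg me (entered cfg s reqs ms)).out,
      (∃ T, y.2 = .request T) ∨
      (∃ T k, y.2 = .support T (entered cfg s reqs ms).st.view k ∧
        (entered cfg s reqs ms).st.halted = false) ∨
      ((entered cfg s reqs ms).st.halted = false ∧
        me = primary n (entered cfg s reqs ms).st.view ∧
        ∃ i T, (tick cfg me s reqs ms).st.proposed[i]? = some T ∧ y.2 = .propose T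
          (entered cfg s reqs ms).st.view ((tick cfg me s reqs ms).st.base + i)) ∨
      (∃ c, y.2 = .certify c) := by
    intro y hy
    have hprop : (tick cfg me s reqs ms).st.proposed = _ := (tick_frame cfg me s reqs ms).2.2.2.2.2.1
    have hbase : (tick cfg me s reqs ms).st.base = _ := (tick_frame cfg me s reqs ms).2.2.2.2.1
    unfold normalCase at hy
    obtain ⟨l, o, h, -, h2⟩ := certifyProposals_shape cfg me
      (proposeRequests me (execute cfg (supportProposals (entered cfg s reqs ms))))
    rw [h, List.mem_append] at hy
    rcases hy with hy | hy
    swap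
    · exact Or.inr (Or.inr (Or.inr (h2 y hy)))
    obtain ⟨l', o', h', -, h3⟩ := proposeRequests_shape me
      (execute cfg (supportProposals (entered cfg s reqs ms)))
    rw [h', List.mem_append] at hy
    rcases hy with hy | hy
    swap
    · obtain ⟨e1, e2, i, T, e3, e4⟩ := h3 y hy
      simp only [execute_frame, supportProposals_frame] at e1 e2 e4
      refine Or.inr (Or.inr (Or.inl ⟨e1, e2,
        (entered cfg s reqs ms).st.proposed.length + i, T, ?_, ?_⟩))
      · rw [hprop, h']
        simp only [execute_frame, supportProposals_frame]
        rw [List.getElem?_append_right (by omega), Nat.add_sub_cancel_left, e3]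
      · rw [hbase, e4]
    simp only [execute_frame] at hy
    obtain ⟨l', o', h', -, h3⟩ := supportProposals_shape (entered cfg s reqs ms)
    rw [h', List.mem_append] at hy
    rcases hy with hy | hy
    · exact Or.inl (entered_out _ _ _ _ y hy)
    · exact Or.inr (Or.inl (h3 y hy))
  have hdet : ∀ y ∈ (detectFailure cfg me
        (advanceTimers (normalCase cfg me (entered cfg s reqs ms)))).out,
      ((∃ T, y.2 = .request T) ∨
      (∃ T k, y.2 = .support T (entered cfg s reqs ms).st.view k ∧
        (entered cfg s reqs ms).st.halted = false) ∨
      ((entered cfg s reqs ms).st.halted = false ∧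
        me = primary n (entered cfg s reqs ms).st.view ∧
        ∃ i T, (tick cfg me s reqs ms).st.proposed[i]? = some T ∧ y.2 = .propose T
          (entered cfg s reqs ms).st.view ((tick cfg me s reqs ms).st.base + i)) ∨
      (∃ c, y.2 = .certify c)) ∨
      (∃ E, y.2 = .vcRequest ⟨me, (tick cfg me s reqs ms).st.view, E⟩ ∧
        (tick cfg me s reqs ms).st.halted = true) := by
    intro y hy
    rcases (detectFailure_out cfg me _).2 y hy with h | ⟨h1, h2⟩
    · simp only [advanceTimers_frame] at h
      exact Or.inl (hnormal y h)
    · refine Or.inr ⟨(advanceTimers (normalCase cfg me (entered cfg s reqs ms))).st.log, ?_, ?_⟩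
      · rw [h1, tick_eq]
        simp only [sendCheckpoint_frame, proposeView_frame]
      · rw [tick_eq]
        simpa using h2
  -- No new-view proposal precedes `proposeView`; hence a tick contains at most one, up to its
  -- destination.
  have hnone : ∀ y ∈ (detectFailure cfg me
      (advanceTimers (normalCase cfg me (entered cfg s reqs ms)))).out,
      ∀ v' vs', y.2 ≠ .nvPropose v' vs' := by
    intro y hy v' vs'
    rcases hdet y hy with (⟨T, h⟩ | ⟨T, k, h, -⟩ | ⟨-, -, i, T, -, h⟩ | ⟨c, h⟩) | ⟨E, h, -⟩ <;>
      simp [h]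
  rw [tick_eq] at hx
  rcases (sendCheckpoint_out _ _ _).2 x hx with h | h
  swap
  · exact Or.inr (Or.inr h)
  rcases proposeView_cases cfg me (detectFailure cfg me
      (advanceTimers (normalCase cfg me (entered cfg s reqs ms)))) with
    ⟨h', -⟩ | ⟨h1, h2, vs, h3, h'⟩
  · rw [h'] at h
    exact Or.inl (hdet x h)
  · have hview : (tick cfg me s reqs ms).st.view = (detectFailure cfg me
        (advanceTimers (normalCase cfg me (entered cfg s reqs ms)))).st.view := by
      simp [tick_eq]
    have hlast : (tick cfg me s reqs ms).st.lastNewView = (detectFailure cfg me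
        (advanceTimers (normalCase cfg me (entered cfg s reqs ms)))).st.view + 1 := by
      rw [tick_eq]
      simp [h']
    have hout := h
    rw [h', List.mem_append] at h
    rcases h with h | h
    · exact Or.inl (hdet x h)
    · refine Or.inr (Or.inl ⟨by rwa [hview], ?_, by rw [hlast, hview], vs,
        by rw [mem_broadcast.1 h, hview], by rwa [hview], ?_⟩)
      · rw [hview]
        simpa using h2
      · intro y hy v' vs' hy'
        rw [tick_eq] at hy
        rcases (sendCheckpoint_out _ _ _).2 y hy with h | ⟨E, h⟩
        · rw [h', List.mem_append] at h
          rcases h with h | h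
          · exact absurd hy' (hnone y h v' vs')
          · have := mem_broadcast.1 h
            rw [hy'] at this
            simp at this
            exact this.2
        · rw [hy'] at h
          simp at h

/-- Read contrapositively, the first alternative says that the next primary, once it holds requests
of `nf` replicas, must have proposed the view. -/
theorem lastNewView_tick (cfg : Config) (me : Fin n) (s : State n Req) (reqs : List Req)
    (ms : List (Fin n × Msg n Req)) :
    ((tick cfg me s reqs ms).st.lastNewView = s.lastNewView ∧
      (me = primary n ((tick cfg me s reqs ms).st.view + 1) →
        s.lastNewView < (tick cfg me s reqs ms).st.view + 1 →
        ((List.finRange n).filterMap (firstVcRequest cfg (tick cfg me s reqs ms).st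
          (tick cfg me s reqs ms).st.view)).length < cfg.nf n)) ∨
    (s.lastNewView < (tick cfg me s reqs ms).st.view + 1 ∧
      (tick cfg me s reqs ms).st.lastNewView = (tick cfg me s reqs ms).st.view + 1 ∧ ∃ vs,
        ∀ r, (r, .nvPropose ((tick cfg me s reqs ms).st.view + 1) vs) ∈
          (tick cfg me s reqs ms).out) := by
  have hview : (tick cfg me s reqs ms).st.view = (detectFailure cfg me
      (advanceTimers (normalCase cfg me (entered cfg s reqs ms)))).st.view := by
    simp [tick_eq]
  have hlast : (tick cfg me s reqs ms).st.lastNewView = (proposeView cfg me (detectFailure cfg me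
      (advanceTimers (normalCase cfg me (entered cfg s reqs ms))))).st.lastNewView := by
    simp [tick_eq]
  have hvc : firstVcRequest cfg (tick cfg me s reqs ms).st = firstVcRequest cfg
      (detectFailure cfg me
        (advanceTimers (normalCase cfg me (entered cfg s reqs ms)))).st := by
    funext v p
    simp [firstVcRequest]
  rw [hview, hlast, hvc]
  rcases proposeView_cases cfg me (detectFailure cfg me
      (advanceTimers (normalCase cfg me (entered cfg s reqs ms)))) with
    ⟨h', h⟩ | ⟨h1, h2, vs, h3, h'⟩
  · left
    rw [h']
    simpa using h
  · right
    refine ⟨by simpa using h2, by rw [h'], vs, fun r => ?_⟩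
    rw [tick_eq]
    apply (sendCheckpoint_out _ _ _).1
    rw [h']
    exact List.mem_append_right _ (mem_broadcast.2 rfl)

theorem checkpoint_mem_tick_out (cfg : Config) (me : Fin n) (s : State n Req) (reqs : List Req)
    (ms : List (Fin n × Msg n Req))
    (h : (s.clock + 1) % cfg.period = 0 ∨ (tick cfg me s reqs ms).st.log ≠ s.log) (r : Fin n) :
    (r, .checkpoint (tick cfg me s reqs ms).st.log) ∈ (tick cfg me s reqs ms).out := by
  rw [(tick_frame cfg me s reqs ms).1] at h ⊢
  rw [tick_eq]
  unfold sendCheckpoint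
  rw [if_pos (by simpa using h)]
  exact List.mem_append_right _ (mem_broadcast.2 (by simp))

/-! ### Levels -/

/-- A replica passes level `2 * v` when it enters view `v`, and level `2 * v + 1` when it requests
to replace the primary of view `v`. -/
def State.level (s : State n Req) : ℕ := 2 * s.view + (if s.halted then 1 else 0)

theorem State.level_of_halted {s : State n Req} (h : s.halted = true) :
    s.level = 2 * s.view + 1 := by simp [State.level, h]

theorem State.level_of_not_halted {s : State n Req} (h : s.halted = false) :
    s.level = 2 * s.view := by simp [State.level, h]

theorem State.level_eq_even {s : State n Req} {v : ℕ} :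
    s.level = 2 * v ↔ s.view = v ∧ s.halted = false := by
  unfold State.level
  cases s.halted <;> simp <;> omega

theorem State.level_eq_odd {s : State n Req} {v : ℕ} :
    s.level = 2 * v + 1 ↔ s.view = v ∧ s.halted = true := by
  unfold State.level
  cases s.halted <;> simp <;> omega

/-- The exponent `(level + 1) / 2` agrees at levels `2 * v + 1` and `2 * v + 2`: entering a view
does not alter the timeout, only a view-change request doubles it or leaves a view for the doubled
one. -/
theorem State.timeout_eq (cfg : Config) (s : State n Req) :
    s.timeout cfg = cfg.δ * 2 ^ ((s.level + 1) / 2) := by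
  unfold State.timeout State.level
  cases s.halted
  · simp; left; omega
  · simp; left; omega

theorem level_entered (cfg : Config) (s : State n Req) (reqs : List Req)
    (ms : List (Fin n × Msg n Req)) :
    (entered cfg s reqs ms).st.level = s.level ∨
      s.halted = true ∧ (entered cfg s reqs ms).st.level = s.level + 1 := by
  rcases entered_cases cfg s reqs ms with ⟨h1, h2, -⟩ | ⟨h, vs, -, -, h1, h2, -⟩
  · left; simp [State.level, h1, h2]
  · right; simp [State.level, h, h1, h2]; omega

theorem complainers_congr {s s' : State n Req} (h : s.inbox = s'.inbox) (v : ℕ) :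
    complainers s v = complainers s' v := by
  unfold complainers
  rw [h]

/-- The alternatives are whether `detectFailure` stayed silent or requested a view-change. From
level `l` of either parity, a request leads to the next odd level, `2 * ((l + 1) / 2) + 1`. -/
theorem tick_level (cfg : Config) (me : Fin n) (s : State n Req) (reqs : List Req)
    (ms : List (Fin n × Msg n Req)) :
    ((tick cfg me s reqs ms).st.level = (entered cfg s reqs ms).st.level ∧
      (∀ T, (tick cfg me s reqs ms).st.timer T =
        if (tick cfg me s reqs ms).st.pending T then s.timer T + 1 else 0) ∧
      ∀ T, (tick cfg me s reqs ms).st.pending T = true →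
        s.timer T + 1 < cfg.δ * 2 ^ (((entered cfg s reqs ms).st.level + 1) / 2)) ∨
    ((tick cfg me s reqs ms).st.level = 2 * (((entered cfg s reqs ms).st.level + 1) / 2) + 1 ∧
      (∀ T, (tick cfg me s reqs ms).st.timer T = 0) ∧
      ((∃ T, cfg.δ * 2 ^ (((entered cfg s reqs ms).st.level + 1) / 2) ≤ s.timer T + 1) ∨
        ∃ v, (entered cfg s reqs ms).st.level = 2 * v ∧
          cfg.f + 1 ≤ (complainers (tick cfg me s reqs ms).st v).card) ∧
      ∀ r, (r, .vcRequest ⟨me, (tick cfg me s reqs ms).st.view,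
        (tick cfg me s reqs ms).st.log⟩) ∈ (tick cfg me s reqs ms).out) := by
  set b := advanceTimers (normalCase cfg me (entered cfg s reqs ms)) with hb
  have hlev : b.st.level = (entered cfg s reqs ms).st.level := by simp [hb, State.level]
  have hpend : ∀ T, (normalCase cfg me (entered cfg s reqs ms)).st.pending T =
      (tick cfg me s reqs ms).st.pending T := fun T => by simp [State.pending]
  have hpend' : ∀ T, b.st.pending T = (tick cfg me s reqs ms).st.pending T := fun T => by
    simp [State.pending, hb]
  have htimer : ∀ T, b.st.timer T =
      if (tick cfg me s reqs ms).st.pending T then s.timer T + 1 else 0 := fun T => by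
    rw [hb, advanceTimers_timer, hpend]
    simp
  have hview : (tick cfg me s reqs ms).st.view = (detectFailure cfg me b).st.view := by
    simp [tick_eq, hb]
  have hhalted : (tick cfg me s reqs ms).st.halted = (detectFailure cfg me b).st.halted := by
    simp [tick_eq, hb]
  have htimer' : (tick cfg me s reqs ms).st.timer = (detectFailure cfg me b).st.timer := by
    simp [tick_eq, hb]
  have hlevel : (tick cfg me s reqs ms).st.level = (detectFailure cfg me b).st.level := by
    simp [State.level, hview, hhalted]
  have hlog : (tick cfg me s reqs ms).st.log = b.st.log := by simp [hb]
  have hout : (detectFailure cfg me b).out ⊆ (tick cfg me s reqs ms).out := by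
    rw [tick_eq]
    exact List.Subset.trans (subset_proposeView_out cfg me _) (sendCheckpoint_out _ _ _).1
  have hsend : ∀ v, detectFailure cfg me b = requestViewChange me v b → ∀ r,
      (r, .vcRequest ⟨me, (tick cfg me s reqs ms).st.view,
        (tick cfg me s reqs ms).st.log⟩) ∈ (tick cfg me s reqs ms).out := by
    intro v hv r
    apply hout
    rw [hview, hlog, hv]
    exact List.mem_append_right _ (mem_broadcast.2 rfl)
  rcases detectFailure_cases cfg me b with ⟨⟨T, h1, h2, h3⟩, h⟩ | ⟨hh, hc, h⟩ | ⟨hn, h⟩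
  · right
    refine ⟨?_, fun T => by rw [htimer', h]; rfl, Or.inl ⟨T, ?_⟩, hsend _ h⟩
    · rw [hlevel, h, ← hlev]
      cases hh : b.st.halted <;> simp [requestViewChange, State.level, hh] <;> omega
    · rw [State.timeout_eq, hlev, htimer, if_pos (by rw [← hpend']; exact h2)] at h3
      exact h3
  · right
    refine ⟨?_, fun T => by rw [htimer', h]; rfl, Or.inr ⟨b.st.view, ?_, ?_⟩, hsend _ h⟩
    · rw [hlevel, h, ← hlev]
      simp [requestViewChange, State.level, hh]
      omega
    · rw [← hlev, State.level_of_not_halted hh]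
    · rw [complainers_congr (s' := b.st) (by simp [hb])]
      exact hc
  · left
    refine ⟨by rw [hlevel, h, hlev], fun T => by rw [htimer', h, htimer], fun T hT => ?_⟩
    by_contra hcon
    have hp : b.st.pending T = true := by rw [hpend', hT]
    refine hn ⟨T, ?_, hp, ?_⟩
    · simp [State.pending] at hp
      exact hp.1
    · rw [State.timeout_eq, hlev, htimer, if_pos hT]
      omega

end Ticks


/-! ### Levels, timers and kinds of messages in one tick -/

section TickConsequences

variable {n : ℕ} [NeZero n] {Req : Type*} [DecidableEq Req]

theorem level_entered_bounds (cfg : Config) (s : State n Req) (reqs : List Req)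
    (ms : List (Fin n × Msg n Req)) : s.level ≤ (entered cfg s reqs ms).st.level ∧
      (entered cfg s reqs ms).st.level ≤ 2 * ((s.level + 1) / 2) := by
  rcases level_entered cfg s reqs ms with h | ⟨h1, h⟩
  · omega
  · have := State.level_of_halted h1
    omega

/-- Either the timers go on, or the replica requests a view-change. -/
theorem tick_timers (cfg : Config) (me : Fin n) (s : State n Req) (reqs : List Req)
    (ms : List (Fin n × Msg n Req)) :
    (s.level ≤ (tick cfg me s reqs ms).st.level ∧
      (tick cfg me s reqs ms).st.level ≤ 2 * ((s.level + 1) / 2) ∧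
      (∀ T, (tick cfg me s reqs ms).st.timer T =
        if (tick cfg me s reqs ms).st.pending T then s.timer T + 1 else 0) ∧
      ∀ T, (tick cfg me s reqs ms).st.pending T = true →
        s.timer T + 1 < cfg.δ * 2 ^ ((s.level + 1) / 2)) ∨
    ((tick cfg me s reqs ms).st.level = 2 * ((s.level + 1) / 2) + 1 ∧
      (∀ T, (tick cfg me s reqs ms).st.timer T = 0) ∧
      ((∃ T, cfg.δ * 2 ^ ((s.level + 1) / 2) ≤ s.timer T + 1) ∨
        cfg.f + 1 ≤ (complainers (tick cfg me s reqs ms).st ((s.level + 1) / 2)).card) ∧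
      ∀ r, (r, .vcRequest ⟨me, (s.level + 1) / 2,
        (tick cfg me s reqs ms).st.log⟩) ∈ (tick cfg me s reqs ms).out) := by
  obtain ⟨hb1, hb2⟩ := level_entered_bounds cfg s reqs ms
  -- Entering a view goes from an odd level to the next even one, which leaves the exponent of the
  -- timeout unchanged. So `entered` disappears from the statement.
  have hhalf : ((entered cfg s reqs ms).st.level + 1) / 2 = (s.level + 1) / 2 := by omega
  have := tick_level cfg me s reqs ms
  rw [hhalf] at this
  rcases this with ⟨h1, h2, h3⟩ | ⟨h1, h2, h3, h4⟩
  · left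
    refine ⟨by omega, by omega, h2, h3⟩
  · right
    refine ⟨h1, h2, ?_, ?_⟩
    · rcases h3 with h | ⟨v, hv, h⟩
      · exact Or.inl h
      · right
        obtain rfl : v = (s.level + 1) / 2 := by omega
        exact h
    · have hv : (tick cfg me s reqs ms).st.view = (s.level + 1) / 2 := (State.level_eq_odd.1 h1).1
      rwa [hv] at h4

theorem level_le_tick (cfg : Config) (me : Fin n) (s : State n Req) (reqs : List Req)
    (ms : List (Fin n × Msg n Req)) : s.level ≤ (tick cfg me s reqs ms).st.level ∧
      (tick cfg me s reqs ms).st.level ≤ s.level + 2 := by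
  rcases tick_timers cfg me s reqs ms with ⟨h1, h2, -⟩ | ⟨h, -⟩ <;> omega

theorem lastNewView_le_tick (cfg : Config) (me : Fin n) (s : State n Req) (reqs : List Req)
    (ms : List (Fin n × Msg n Req)) :
    s.lastNewView ≤ (tick cfg me s reqs ms).st.lastNewView := by
  rcases lastNewView_tick cfg me s reqs ms with ⟨h, -⟩ | ⟨h1, h2, -⟩ <;> omega

theorem vcRequest_mem_tick_out {cfg : Config} {me : Fin n} {s : State n Req} {reqs : List Req}
    {ms : List (Fin n × Msg n Req)} {d : Fin n} {m : VcRequest n Req}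
    (h : (d, Msg.vcRequest m) ∈ (tick cfg me s reqs ms).out) :
    m.sender = me ∧ (tick cfg me s reqs ms).st.level = 2 * m.view + 1 := by
  rcases tick_out _ _ _ _ _ _ h with ((⟨T, h⟩ | ⟨T, k, h, -⟩ | ⟨-, -, i, T, -, h⟩ | ⟨c, h⟩) |
    ⟨E, h, h'⟩) | ⟨-, -, -, vs, h, -⟩ | ⟨E, h⟩ <;> simp at h
  subst h
  exact ⟨rfl, State.level_of_halted h'⟩

theorem support_mem_tick_out {cfg : Config} {me : Fin n} {s : State n Req} {reqs : List Req}
    {ms : List (Fin n × Msg n Req)} {d : Fin n} {T : Req} {v k : ℕ}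
    (h : (d, Msg.support T v k) ∈ (tick cfg me s reqs ms).out) :
    (entered cfg s reqs ms).st.level = 2 * v := by
  rcases tick_out _ _ _ _ _ _ h with ((⟨T, h⟩ | ⟨T, k, h, h'⟩ | ⟨-, -, i, T, -, h⟩ | ⟨c, h⟩) |
    ⟨E, h, h'⟩) | ⟨-, -, -, vs, h, -⟩ | ⟨E, h⟩ <;> simp at h
  rw [h.2.1]
  exact State.level_of_not_halted h'

theorem propose_mem_tick_out {cfg : Config} {me : Fin n} {s : State n Req} {reqs : List Req}
    {ms : List (Fin n × Msg n Req)} {d : Fin n} {T : Req} {v k : ℕ}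
    (h : (d, Msg.propose T v k) ∈ (tick cfg me s reqs ms).out) :
    (entered cfg s reqs ms).st.level = 2 * v ∧ ∃ i,
      (tick cfg me s reqs ms).st.proposed[i]? = some T ∧
      k = (tick cfg me s reqs ms).st.base + i := by
  rcases tick_out _ _ _ _ _ _ h with ((⟨T, h⟩ | ⟨T, k, h, h'⟩ | ⟨h1, -, i, T, h2, h⟩ | ⟨c, h⟩) |
    ⟨E, h, h'⟩) | ⟨-, -, -, vs, h, -⟩ | ⟨E, h⟩ <;> simp at h
  obtain ⟨rfl, rfl, rfl⟩ := h
  exact ⟨State.level_of_not_halted h1, i, h2, by simp⟩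

theorem nvPropose_mem_tick_out {cfg : Config} {me : Fin n} {s : State n Req} {reqs : List Req}
    {ms : List (Fin n × Msg n Req)} {d : Fin n} {v : ℕ} {vs : List (VcRequest n Req)}
    (h : (d, Msg.nvPropose v vs) ∈ (tick cfg me s reqs ms).out) :
    s.lastNewView < v ∧ (tick cfg me s reqs ms).st.lastNewView = v ∧
    validNewView cfg v vs = true ∧
    ∀ d' v' vs', (d', Msg.nvPropose v' vs') ∈ (tick cfg me s reqs ms).out → vs' = vs := by
  rcases tick_out _ _ _ _ _ _ h with ((⟨T, h⟩ | ⟨T, k, h, h'⟩ | ⟨h1, -, i, T, h2, h⟩ | ⟨c, h⟩) |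
    ⟨E, h, h'⟩) | ⟨-, h1, h2, vs, h, h3, h4⟩ | ⟨E, h⟩ <;> simp at h
  obtain ⟨rfl, rfl⟩ := h
  exact ⟨h1, h2, h3, fun d' v' vs' h => h4 _ h _ _ rfl⟩

end TickConsequences

/-! ### Monotonicity along a run, and the timing of view-changes -/

namespace Run

variable {n : ℕ} [NeZero n] {Req : Type*} [DecidableEq Req] {F : Finset (Fin n)} {cfg : Config}

theorem state_succ' (ρ : Run n Req F cfg) (t : ℕ) {r : Fin n} (hr : r ∉ F) :
    ρ.state (t + 1) r = (ρ.progress t r).st := ρ.state_succ t r hr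

theorem level_mono (ρ : Run n Req F cfg) {r : Fin n} (hr : r ∉ F) {s t : ℕ} (h : s ≤ t) :
    (ρ.state s r).level ≤ (ρ.state t r).level := by
  induction t, h using Nat.le_induction with
  | base => exact le_rfl
  | succ t _ ih => rw [state_succ' ρ t hr]; exact ih.trans (level_le_tick ..).1

theorem level_add_le (ρ : Run n Req F cfg) {r : Fin n} (hr : r ∉ F) (t d : ℕ) :
    (ρ.state (t + d) r).level ≤ (ρ.state t r).level + 2 * d := by
  induction d with
  | zero => exact le_rfl
  | succ d ih =>
    rw [← add_assoc, state_succ' ρ _ hr]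
    have := (level_le_tick cfg r (ρ.state (t + d) r) (ρ.requests (t + d) r)
      (ρ.delivered (t + d) r)).2
    unfold progress
    omega

theorem lastNewView_mono (ρ : Run n Req F cfg) {r : Fin n} (hr : r ∉ F) {s t : ℕ} (h : s ≤ t) :
    (ρ.state s r).lastNewView ≤ (ρ.state t r).lastNewView := by
  induction t, h using Nat.le_induction with
  | base => exact le_rfl
  | succ t _ ih => rw [state_succ' ρ t hr]; exact ih.trans (lastNewView_le_tick ..)

theorem known_mono (ρ : Run n Req F cfg) {r : Fin n} (hr : r ∉ F) {s t : ℕ} (h : s ≤ t) :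
    (ρ.state s r).known ⊆ (ρ.state t r).known := by
  induction t, h using Nat.le_induction with
  | base => exact List.Subset.refl _
  | succ t _ ih =>
    rw [state_succ' ρ t hr]
    exact List.Subset.trans ih (known_subset_tick ..)

theorem inbox_succ (ρ : Run n Req F cfg) (t : ℕ) {r : Fin n} (hr : r ∉ F) :
    (ρ.state (t + 1) r).inbox = (ρ.state t r).inbox ++ ρ.delivered t r := by
  rw [state_succ' ρ t hr]
  simp [progress]

theorem mem_inbox (ρ : Run n Req F cfg) (t : ℕ) {r : Fin n} (hr : r ∉ F)
    (x : Fin n × Msg n Req) :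
    x ∈ (ρ.state t r).inbox ↔ ∃ s < t, x ∈ ρ.delivered s r := by
  induction t with
  | zero => simp [ρ.state_zero r hr, State.init]
  | succ t ih =>
    rw [inbox_succ ρ t hr, List.mem_append, ih]
    constructor
    · rintro (⟨s, hs, h⟩ | h)
      · exact ⟨s, by omega, h⟩
      · exact ⟨t, by omega, h⟩
    · rintro ⟨s, hs, h⟩
      rcases Nat.lt_succ_iff_lt_or_eq.1 hs with h' | rfl
      · exact Or.inl ⟨s, h', h⟩
      · exact Or.inr h

theorem sent_of_mem_inbox (ρ : Run n Req F cfg) {t : ℕ} {r p : Fin n} (hr : r ∉ F) (hp : p ∉ F)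
    {m : Msg n Req} (h : (p, m) ∈ (ρ.state t r).inbox) :
    ∃ s, s + 1 < t ∧ (r, m) ∈ (ρ.progress s p).out := by
  obtain ⟨t', ht', h⟩ := (mem_inbox ρ t hr _).1 h
  obtain ⟨s, hs, h⟩ := ρ.authentic t' r hr p hp m h
  exact ⟨s, by omega, h⟩

theorem Reliable.mem_inbox {ρ : Run n Req F cfg} {Δ a b : ℕ} (hrel : ρ.Reliable Δ a b)
    {s : ℕ} (has : a ≤ s) (hsb : s + Δ ≤ b) {p r : Fin n} (hp : p ∉ F) (hr : r ∉ F)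
    {m : Msg n Req} (h : (r, m) ∈ (ρ.progress s p).out) {t : ℕ} (ht : s + Δ < t) :
    (p, m) ∈ (ρ.state t r).inbox := by
  obtain ⟨t', h1, h2, h3⟩ := hrel s has hsb p hp r hr m h
  exact (Run.mem_inbox ρ t hr _).2 ⟨t', by omega, h3⟩

theorem clock_eq (ρ : Run n Req F cfg) (t : ℕ) {r : Fin n} (hr : r ∉ F) :
    (ρ.state t r).clock = t := by
  induction t with
  | zero => simp [ρ.state_zero r hr, State.init]
  | succ t ih => rw [state_succ' ρ t hr]; simp [progress, ih]

/-- Shows that a replica in a view below `u - 1` has not yet proposed view `u`. -/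
theorem lastNewView_le (ρ : Run n Req F cfg) (t : ℕ) {r : Fin n} (hr : r ∉ F) :
    (ρ.state t r).lastNewView ≤ (ρ.state t r).view + 1 := by
  induction t with
  | zero => simp [ρ.state_zero r hr, State.init]
  | succ t ih =>
    have h1 := level_mono ρ hr (show t ≤ t + 1 by omega)
    have h2 : (ρ.state t r).view ≤ (ρ.state (t + 1) r).view := by
      unfold State.level at h1
      split at h1 <;> split at h1 <;> omega
    rw [state_succ' ρ t hr] at h2 ⊢
    unfold progress at h2 ⊢
    rcases lastNewView_tick cfg r (ρ.state t r) (ρ.requests t r) (ρ.delivered t r) with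
      ⟨h, -⟩ | ⟨-, h, -⟩ <;> omega

/-- Requests to replace a primary by a non-faulty replica. -/
theorem level_of_vcRequest_mem_inbox (ρ : Run n Req F cfg) {t : ℕ} {r q : Fin n} (hr : r ∉ F)
    {m : VcRequest n Req} (h : (q, Msg.vcRequest m) ∈ (ρ.state t r).inbox) (hm : m.sender ∉ F) :
    ∃ s, s + 1 < t ∧ (ρ.state (s + 1) m.sender).level = 2 * m.view + 1 := by
  obtain ⟨t', ht', h⟩ := (mem_inbox ρ t hr _).1 h
  obtain ⟨s, hs, d, h⟩ := ρ.unforgeable_vcRequests t' r hr _ h m (by simp [Msg.vcRequests]) hm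
  refine ⟨s, by omega, ?_⟩
  rw [state_succ' ρ s hm]
  exact (vcRequest_mem_tick_out h).2

/-! ### Timing of view-changes -/

/-- The timer of `T` grows in every tick until the replica requests a view-change. At levels `2 * w
- 1` and `2 * w` the timeout is `δ * 2 ^ w`, and any request made there leads to level `2 * w + 1`;
moving from the first to the second does not reset the timer. -/
theorem level_of_pending (ρ : Run n Req F cfg) (hδ : 0 < cfg.δ) {q : Fin n} (hq : q ∉ F)
    {T : Req} {t w : ℕ}
    (hT : ∀ i ≤ cfg.δ * 2 ^ w, (ρ.state (t + i) q).pending T = true)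
    (hw : 2 * w ≤ (ρ.state t q).level + 1) :
    2 * w + 1 ≤ (ρ.state (t + cfg.δ * 2 ^ w) q).level := by
  have hpos : 0 < cfg.δ * 2 ^ w := by positivity
  have key : ∀ i ≤ cfg.δ * 2 ^ w, 2 * w + 1 ≤ (ρ.state (t + i) q).level ∨
      (2 * w ≤ (ρ.state (t + i) q).level + 1 ∧ i ≤ (ρ.state (t + i) q).timer T ∧
        i < cfg.δ * 2 ^ w) := by
    intro i hi
    induction i with
    | zero => exact Or.inr ⟨hw, Nat.zero_le _, hpos⟩
    | succ i ih =>
      have hmono := level_mono ρ hq (show t + i ≤ t + (i + 1) by omega)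
      rcases ih (by omega) with h | ⟨h1, h2, h3⟩
      · left; omega
      · by_cases hcon : 2 * w + 1 ≤ (ρ.state (t + i) q).level
        · left; omega
        have hhalf : ((ρ.state (t + i) q).level + 1) / 2 = w := by omega
        have hpend := hT (i + 1) hi
        rw [← add_assoc] at hpend hmono ⊢
        rw [state_succ' ρ _ hq] at hpend hmono ⊢
        unfold progress at hpend hmono ⊢
        rcases tick_timers cfg q (ρ.state (t + i) q) (ρ.requests (t + i) q)
          (ρ.delivered (t + i) q) with ⟨-, -, h5, h6⟩ | ⟨h4, -⟩
        · right
          have h6 := h6 T hpend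
          rw [hhalf] at h6
          refine ⟨by omega, ?_, by omega⟩
          rw [h5, if_pos hpend]
          omega
        · left
          omega
  rcases key _ le_rfl with h | ⟨-, -, h⟩
  · exact h
  · omega

/-- To pass level `2 * (w + 1)`, the first non-faulty replica to do so needs an expired timer, as `f
+ 1` complaints about view `w + 1` would include one of an earlier non-faulty replica. But it
reached level `2 * w + 1` within the interval, and its timers restarted then. Hence the induction
treats all replicas at once and carries a bound on the timers. -/
theorem level_le_of_timeout (ρ : Run n Req F cfg) (hf : cfg.f = F.card) {t w : ℕ}
    (h0 : ∀ q ∉ F, (ρ.state t q).level ≤ 2 * w) :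
    ∀ q ∉ F, (ρ.state (t + cfg.δ * 2 ^ (w + 1)) q).level ≤ 2 * (w + 1) := by
  have key : ∀ i ≤ cfg.δ * 2 ^ (w + 1), ∀ q ∉ F, (ρ.state (t + i) q).level ≤ 2 * (w + 1) ∧
      (2 * w + 1 ≤ (ρ.state (t + i) q).level → ∀ T, (ρ.state (t + i) q).timer T < i) := by
    intro i hi
    induction i with
    | zero => intro q hq; have := h0 q hq; rw [add_zero]; exact ⟨by omega, by omega⟩
    | succ i ih =>
      intro q hq
      obtain ⟨h1, h2⟩ := ih (by omega) q hq
      have hinbox := fun q' m => level_of_vcRequest_mem_inbox ρ (t := t + i + 1) hq (q := q') (m := m)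
      rw [← add_assoc]
      rw [state_succ' ρ _ hq] at hinbox ⊢
      unfold progress at hinbox ⊢
      rcases tick_timers cfg q (ρ.state (t + i) q) (ρ.requests (t + i) q)
          (ρ.delivered (t + i) q) with ⟨h3, h4, h5, -⟩ | ⟨h3, h4, h5, -⟩
      · refine ⟨by omega, fun h T => ?_⟩
        have := h2 (by omega) T
        rw [h5]
        split <;> omega
      · refine ⟨?_, fun _ T => by rw [h4]; omega⟩
        by_contra hcon
        have hhalf : ((ρ.state (t + i) q).level + 1) / 2 = w + 1 := by omega
        rw [hhalf] at h5
        rcases h5 with ⟨T, h5⟩ | h5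
        · have := h2 (by omega) T
          omega
        -- More than `F.card` complainers: one of them is non-faulty and was at level `2 * (w + 1) +
        -- 1` at an earlier time, against the induction hypothesis.
        · obtain ⟨p, hp, hpF⟩ := Finset.exists_mem_notMem_of_card_lt_card
            (s := F) (by rw [hf] at h5; exact h5)
          simp only [complainers, Finset.mem_filter, Finset.mem_univ, true_and,
            List.any_eq_true] at hp
          obtain ⟨⟨q', m⟩, hm, hp⟩ := hp
          cases m <;> simp at hp
          rename_i m
          obtain ⟨rfl, hv⟩ := hp
          obtain ⟨s, hs, h6⟩ := hinbox q' m hm hpF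
          have := (ih (by omega) _ hpF).1
          have := level_mono ρ hpF (show s + 1 ≤ t + i by omega)
          omega
  exact fun q hq => (key _ le_rfl q hq).1

/-- The waiting times add up to `δ * (1 + 2 + ⋯ + 2 ^ w)`, which is less than `δ * 2 ^ (w + 1)`. -/
theorem level_ge (ρ : Run n Req F cfg) (hδ : 0 < cfg.δ) {q : Fin n} (hq : q ∉ F) {T : Req}
    {a : ℕ} (w : ℕ)
    (hT : ∀ t, a ≤ t → t ≤ a + cfg.δ * 2 ^ (w + 1) → (ρ.state t q).pending T = true) :
    2 * w + 1 ≤ (ρ.state (a + cfg.δ * 2 ^ (w + 1)) q).level := by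
  induction w with
  | zero =>
    have := level_of_pending ρ hδ hq (T := T) (t := a) (w := 0)
      (fun i hi => hT _ (by omega) (by omega)) (by omega)
    exact this.trans (level_mono ρ hq (by omega))
  | succ w ih =>
    have hdbl : cfg.δ * 2 ^ (w + 1 + 1) = cfg.δ * 2 ^ (w + 1) + cfg.δ * 2 ^ (w + 1) := by ring
    rw [hdbl] at hT ⊢
    have := ih (fun t h1 h2 => hT t h1 (by omega))
    rw [← add_assoc]
    exact level_of_pending ρ hδ hq (T := T) (fun i hi => hT _ (by omega) (by omega)) (by omega)

/-- Iterates `level_le_of_timeout` for `W`, ..., `W + k - 1`. The hypothesis `hd` says that `d` is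
the sum `δ * (2 ^ (W + 1) + ⋯ + 2 ^ (W + k))`, without subtraction. -/
theorem level_le (ρ : Run n Req F cfg) (hf : cfg.f = F.card) {a W : ℕ}
    (ha : ∀ q ∉ F, (ρ.state a q).level ≤ 2 * W) (k d : ℕ)
    (hd : d + cfg.δ * 2 ^ (W + 1) = cfg.δ * 2 ^ (W + k + 1)) :
    ∀ q ∉ F, (ρ.state (a + d) q).level ≤ 2 * (W + k) := by
  induction k generalizing d with
  | zero => obtain rfl : d = 0 := by rw [add_zero] at hd; omega
            exact ha
  | succ k ih =>
    have hdbl : cfg.δ * 2 ^ (W + (k + 1) + 1) =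
      cfg.δ * 2 ^ (W + k + 1) + cfg.δ * 2 ^ (W + k + 1) := by ring
    have hle : cfg.δ * 2 ^ (W + 1) ≤ cfg.δ * 2 ^ (W + k + 1) :=
      Nat.mul_le_mul_left _ (Nat.pow_le_pow_right (by norm_num) (by omega))
    obtain ⟨d', rfl⟩ : ∃ d', d = d' + cfg.δ * 2 ^ (W + k + 1) :=
      ⟨d - cfg.δ * 2 ^ (W + k + 1), by omega⟩
    have := level_le_of_timeout ρ hf (ih d' (by omega))
    rwa [add_assoc] at this

end Run


/-! ### Certified logs, and how a request comes to be executed -/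

section Logs

variable {n : ℕ} [NeZero n] {Req : Type*} [DecidableEq Req]

theorem State.pending_iff {s : State n Req} {T : Req} :
    s.pending T = true ↔ T ∈ s.known ∧ ∀ c ∈ s.log, c.req ≠ T := by
  simp [State.pending]

/-! ### Validity of logs -/

theorem validLog_nil (cfg : Config) : validLog cfg ([] : List (Cert n Req)) = true := by
  simp [validLog]

theorem validLog_append {cfg : Config} {E : List (Cert n Req)} {c : Cert n Req}
    (hE : validLog cfg E = true) (hc : c.valid cfg = true) (hs : c.seq = E.length) :
    validLog cfg (E ++ [c]) = true := by
  simp only [validLog, Bool.and_eq_true, decide_eq_true_eq, List.all_eq_true] at hE ⊢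
  refine ⟨by simp [hE.1, hs, List.range_succ], fun x hx => ?_⟩
  rcases List.mem_append.1 hx with h | h
  · exact hE.2 x h
  · rwa [List.mem_singleton.1 h]

theorem validLog_longestLog {cfg : Config} {v : ℕ} {vs : List (VcRequest n Req)}
    (h : validNewView cfg v vs = true) : validLog cfg (longestLog vs) = true := by
  simp only [validNewView, Bool.and_eq_true, decide_eq_true_eq, List.all_eq_true] at h
  unfold longestLog
  refine List.foldlRecOn (motive := fun E => validLog cfg E = true) _ _ (validLog_nil cfg) ?_
  intro E hE m hm
  split
  · exact (h.2 m hm).2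
  · exact hE

/-- The executed transactions and those of the remembered checkpoints are certified. -/
def State.ValidLogs (cfg : Config) (s : State n Req) : Prop :=
  validLog cfg s.log = true ∧ ∀ E ∈ s.checkpoints, validLog cfg E = true

theorem validLogs_receive {cfg : Config} {reqs : List Req} {ms : List (Fin n × Msg n Req)}
    {a : Progress n Req} (h : a.st.ValidLogs cfg) :
    (receive cfg reqs ms a).st.ValidLogs cfg := by
  refine ⟨by simpa using h.1, fun E hE => ?_⟩
  rcases (receive_checkpoints _ _ _ _ _).1 hE with hE | hE
  · exact h.2 E hE
  · exact hE.1

theorem validLogs_catchUp {cfg : Config} {a : Progress n Req} (h : a.st.ValidLogs cfg) :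
    (catchUp a).st.ValidLogs cfg := by
  unfold catchUp
  split
  · refine ⟨?_, by simp⟩
    dsimp only
    refine List.foldlRecOn (motive := fun b : Progress n Req => validLog cfg b.st.log = true) _ _
      h.1 ?_
    intro b hb E hE
    split
    · exact h.2 E hE
    · exact hb
  · exact h

theorem validLogs_enterView {cfg : Config} {a : Progress n Req} (h : a.st.ValidLogs cfg) :
    (enterView cfg a).st.ValidLogs cfg := by
  rcases enterView_cases cfg a with ⟨h', -⟩ | ⟨-, vs, -, h1, h2, -⟩
  · rwa [h']
  · rw [h2]
    exact ⟨validLog_longestLog h1, h.2⟩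

theorem validLogs_execute {cfg : Config} {a : Progress n Req} (h : a.st.ValidLogs cfg) :
    (execute cfg a).st.ValidLogs cfg := by
  refine execute_induction (fun b => b.st.ValidLogs cfg) h ?_
  intro b hb _
  rcases executeNext_cases cfg b with ⟨h', _⟩ | ⟨p, c, -, h1, h2, h'⟩
  · rwa [h']
  · rw [h']
    exact ⟨validLog_append hb.1 (viewCommits_iff.1 h1).2 h2, hb.2⟩

theorem validLogs_tick {cfg : Config} {me : Fin n} {s : State n Req} {reqs : List Req}
    {ms : List (Fin n × Msg n Req)} (h : s.ValidLogs cfg) :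
    (tick cfg me s reqs ms).st.ValidLogs cfg := by
  have h1 : (entered cfg s reqs ms).st.ValidLogs cfg :=
    validLogs_enterView (validLogs_catchUp (validLogs_receive h))
  have h2 : (supportProposals (entered cfg s reqs ms)).st.ValidLogs cfg := by
    simpa [State.ValidLogs] using h1
  simpa [State.ValidLogs] using validLogs_execute h2

/-! ### Executions -/

/-- If `T` is executed, then it was executed in this tick. -/
def Progress.Accounts (T : Req) (a : Progress n Req) : Prop :=
  (∃ c ∈ a.execs, c.req = T) ∨ ∀ c ∈ a.st.log, c.req ≠ T

theorem Progress.Accounts.moveTo {T : Req} {a : Progress n Req} (h : a.Accounts T)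
    (E : List (Cert n Req)) : (a.moveTo E).Accounts T := by
  rcases h with ⟨c, hc, h⟩ | h
  · exact Or.inl ⟨c, List.mem_append_left _ hc, h⟩
  · by_cases hE : ∃ c ∈ E, c.req = T
    · obtain ⟨c, hc, hT⟩ := hE
      refine Or.inl ⟨c, List.mem_append_right _ (List.mem_filter.2 ⟨hc, ?_⟩), hT⟩
      simp only [decide_eq_true_eq]
      exact fun h' => h c h' hT
    · push Not at hE
      exact Or.inr hE

theorem accounts_catchUp {T : Req} {a : Progress n Req} (h : a.Accounts T) :
    (catchUp a).Accounts T := by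
  unfold catchUp
  split
  · exact List.foldlRecOn (motive := fun b : Progress n Req => b.Accounts T) _ _ h
      fun b hb E _ => by
        split
        · exact hb.moveTo E
        · exact hb
  · exact h

theorem accounts_entered (cfg : Config) {s : State n Req} {T : Req}
    (h : ∀ c ∈ s.log, c.req ≠ T) (reqs : List Req) (ms : List (Fin n × Msg n Req)) :
    (entered cfg s reqs ms).Accounts T := by
  have h1 : (catchUp (receive cfg reqs ms ⟨s, [], []⟩)).Accounts T :=
    accounts_catchUp (Or.inr (by simpa using h))
  unfold entered
  rcases enterView_cases cfg (catchUp (receive cfg reqs ms ⟨s, [], []⟩)) with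
    ⟨h', -⟩ | ⟨-, vs, -, -, h2, h3, -⟩
  · rwa [h']
  · have := h1.moveTo (longestLog vs)
    unfold Progress.Accounts at this ⊢
    rw [h2, h3]
    exact this

/-- A request can enter the log only through a recorded execution. The invariant `Accounts` is a
disjunction because an execution may be rolled back within the same tick. -/
theorem not_mem_log_tick {cfg : Config} {me : Fin n} {s : State n Req} {reqs : List Req}
    {ms : List (Fin n × Msg n Req)} {T : Req} (h : ∀ c ∈ s.log, c.req ≠ T)
    (h' : ∀ c ∈ (tick cfg me s reqs ms).execs, c.req ≠ T) :
    ∀ c ∈ (tick cfg me s reqs ms).st.log, c.req ≠ T := by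
  have h1 := accounts_entered cfg h reqs ms
  have h2 : (execute cfg (supportProposals (entered cfg s reqs ms))).Accounts T := by
    obtain ⟨l, hl, -⟩ := execute_shape cfg (supportProposals (entered cfg s reqs ms))
    rw [hl]
    unfold Progress.Accounts at h1 ⊢
    simp only [supportProposals_frame, List.mem_append]
    rcases h1 with ⟨c, hc, hT⟩ | h1
    · exact Or.inl ⟨c, Or.inl hc, hT⟩
    · by_cases hE : ∃ c ∈ l, c.req = T
      · obtain ⟨c, hc, hT⟩ := hE
        exact Or.inl ⟨c, Or.inr hc, hT⟩
      · push Not at hE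
        exact Or.inr fun c hc => hc.elim (h1 c) (hE c)
  simp only [tick_frame] at h' ⊢
  rcases h2 with ⟨c, hc, hT⟩ | h2
  · exact absurd hT (h' c hc)
  · exact h2

/-- Checkpoints inspected before `E` either contain `T`, and then `T` is executed from them, or
leave `T` waiting, so that `E` is used when its turn comes. -/
theorem executes_of_checkpoint {T : Req} {a : Progress n Req} (hh : a.st.halted = true)
    (hT : a.st.pending T = true) {E : List (Cert n Req)} (hE : E ∈ a.st.checkpoints)
    (hET : ∃ c ∈ E, c.req = T) : ∃ c ∈ (catchUp a).execs, c.req = T := by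
  unfold catchUp
  rw [if_pos hh]
  dsimp only
  suffices H : ∀ (l : List (List (Cert n Req))) (b : Progress n Req), T ∈ b.st.known →
      (∃ c ∈ b.execs, c.req = T) ∨ (∀ c ∈ b.st.log, c.req ≠ T) ∧ E ∈ l →
      ∃ c ∈ (l.foldl (fun b E => if E.any (fun c => b.st.pending c.req) then b.moveTo E else b)
        b).execs, c.req = T from
    H _ _ (State.pending_iff.1 hT).1 (Or.inr ⟨(State.pending_iff.1 hT).2, hE⟩)
  intro l
  induction l with
  | nil => intro b _ h; simpa using h
  | cons E' l ih =>
    intro b hk h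
    rw [List.foldl_cons]
    apply ih
    · split <;> exact hk
    · rcases h with ⟨c, hc, h⟩ | ⟨h1, h2⟩
      · left
        refine ⟨c, ?_, h⟩
        split
        · exact List.mem_append_left _ hc
        · exact hc
      · by_cases hE' : ∃ c ∈ E', c.req = T
        · left
          obtain ⟨c, hc, hcT⟩ := hE'
          have hany : E'.any (fun c => b.st.pending c.req) = true :=
            List.any_eq_true.2 ⟨c, hc, State.pending_iff.2 ⟨hcT ▸ hk, hcT ▸ h1⟩⟩
          rw [if_pos hany]
          refine ⟨c, List.mem_append_right _ (List.mem_filter.2 ⟨hc, ?_⟩), hcT⟩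
          simp only [decide_eq_true_eq]
          exact fun h' => h1 c h' hcT
        · right
          refine ⟨?_, ?_⟩
          · push Not at hE'
            split
            · exact hE'
            · exact h1
          · rcases List.mem_cons.1 h2 with rfl | h2
            · exact absurd hET hE'
            · exact h2

theorem exists_mem_execs_tick {cfg : Config} {me : Fin n} {s : State n Req} {reqs : List Req}
    {ms : List (Fin n × Msg n Req)} {T : Req} (hh : s.halted = true) (hT : s.pending T = true)
    {E : List (Cert n Req)}
    (hE : E ∈ s.checkpoints ∨ validLog cfg E = true ∧ ∃ p, (p, Msg.checkpoint E) ∈ ms)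
    (hET : ∃ c ∈ E, c.req = T) : ∃ c ∈ (tick cfg me s reqs ms).execs, c.req = T := by
  have hT' := State.pending_iff.1 hT
  obtain ⟨c, hc, hcT⟩ := executes_of_checkpoint (a := receive cfg reqs ms ⟨s, [], []⟩) (T := T)
    (by simpa using hh) (State.pending_iff.2 ⟨known_subset_receive _ _ _ _ hT'.1, by
      simpa using hT'.2⟩) ((receive_checkpoints _ _ _ _ _).2 hE) hET
  have hsub : (catchUp (receive cfg reqs ms ⟨s, [], []⟩)).execs ⊆
      (tick cfg me s reqs ms).execs := by
    simp only [tick_frame]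
    obtain ⟨l, hl, -⟩ := execute_shape cfg (supportProposals (entered cfg s reqs ms))
    rw [hl]
    simp only [supportProposals_frame]
    refine List.Subset.trans ?_ (List.subset_append_left _ _)
    unfold entered
    rcases enterView_cases cfg (catchUp (receive cfg reqs ms ⟨s, [], []⟩)) with
      ⟨h', -⟩ | ⟨-, vs, -, -, -, h3, -⟩
    · rw [h']; exact List.Subset.refl _
    · rw [h3]; exact List.subset_append_left _ _
  exact ⟨c, hsub hc, hcT⟩

theorem mem_checkpoints_tick {cfg : Config} {me : Fin n} {s : State n Req} {reqs : List Req}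
    {ms : List (Fin n × Msg n Req)} (hh : s.halted = false) {E : List (Cert n Req)}
    (hE : E ∈ s.checkpoints ∨ validLog cfg E = true ∧ ∃ p, (p, Msg.checkpoint E) ∈ ms) :
    E ∈ (tick cfg me s reqs ms).st.checkpoints := by
  simp only [tick_frame, entered, enterView_frame]
  rw [catchUp_of_not_halted (by simpa using hh)]
  exact (receive_checkpoints _ _ _ _ _).2 hE

end Logs

/-! ### Recovery by checkpoints: one replica missing `T` means all are missing it -/

namespace Run

variable {n : ℕ} [NeZero n] {Req : Type*} [DecidableEq Req] {F : Finset (Fin n)} {cfg : Config}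

theorem validLogs (ρ : Run n Req F cfg) (t : ℕ) {r : Fin n} (hr : r ∉ F) :
    (ρ.state t r).ValidLogs cfg := by
  induction t with
  | zero => rw [ρ.state_zero r hr]; exact ⟨validLog_nil cfg, by simp [State.init]⟩
  | succ t ih => rw [state_succ' ρ t hr]; exact validLogs_tick ih

theorem pending_of_not_executes (ρ : Run n Req F cfg) {r : Fin n} (hr : r ∉ F) {T : Req}
    {a b : ℕ} (hk : T ∈ (ρ.state a r).known) (hne : ¬ ρ.Executes r T a b) {t : ℕ} (hat : a ≤ t)
    (htb : t ≤ b) : (ρ.state t r).pending T = true := by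
  unfold Executes at hne
  push Not at hne
  refine State.pending_iff.2 ⟨known_mono ρ hr hat hk, ?_⟩
  induction t, hat using Nat.le_induction with
  | base => exact hne.1
  | succ t hat ih =>
    rw [state_succ' ρ t hr]
    exact not_mem_log_tick (ih (by omega)) (hne.2 t hat (by omega))

/-- A replica left in the dark recovers from a checkpoint. -/
theorem executes_of_delivered_checkpoint (ρ : Run n Req F cfg) (hδ : 0 < cfg.δ) {r : Fin n}
    (hr : r ∉ F) {T : Req} {a b : ℕ} (hk : T ∈ (ρ.state a r).known) {t v : ℕ} (hat : a ≤ t)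
    {p : Fin n} {E : List (Cert n Req)} (hd : (p, Msg.checkpoint E) ∈ ρ.delivered t r)
    (hE : validLog cfg E = true) (hET : ∃ c ∈ E, c.req = T) (hv : (ρ.state t r).view ≤ v)
    (hb : t + cfg.δ * 2 ^ v < b) : ρ.Executes r T a b := by
  by_contra hne
  have hpend := fun t' => pending_of_not_executes ρ hr hk hne (t := t')
  have hexec : ∀ t', a ≤ t' → t' < b → ¬ ∃ c ∈ (ρ.progress t' r).execs, c.req = T := by
    intro t' h1 h2 h3
    exact hne (Or.inr ⟨t', h1, h2, h3⟩)
  have hle : cfg.δ * 2 ^ (ρ.state t r).view ≤ cfg.δ * 2 ^ v :=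
    Nat.mul_le_mul_left _ (Nat.pow_le_pow_right (by norm_num) hv)
  -- Being halted at any of these times would trigger `catchUp` with `E` at hand. So the replica
  -- never halts; then it also cannot leave its view, and it never discards `E`.
  have key : ∀ i ≤ cfg.δ * 2 ^ (ρ.state t r).view,
      (ρ.state (t + i) r).level = 2 * (ρ.state t r).view ∧
      (E ∈ (ρ.state (t + i) r).checkpoints ∨ validLog cfg E = true ∧
        ∃ p, (p, Msg.checkpoint E) ∈ ρ.delivered (t + i) r) := by
    intro i hi
    induction i with
    | zero =>
      refine ⟨State.level_of_not_halted ?_, Or.inr ⟨hE, p, hd⟩⟩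
      by_contra hh
      exact hexec t hat (by omega) (exists_mem_execs_tick (by simpa using hh)
        (hpend t hat (by omega)) (Or.inr ⟨hE, p, hd⟩) hET)
    | succ i ih =>
      obtain ⟨h1, h2⟩ := ih (by omega)
      have h3 : E ∈ (ρ.state (t + (i + 1)) r).checkpoints := by
        rw [← add_assoc, state_succ' ρ _ hr]
        exact mem_checkpoints_tick (State.level_eq_even.1 h1).2 h2
      refine ⟨?_, Or.inl h3⟩
      have hh : (ρ.state (t + (i + 1)) r).halted = false := by
        by_contra hh
        exact hexec (t + (i + 1)) (by omega) (by omega) (exists_mem_execs_tick (by simpa using hh)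
          (hpend _ (by omega) (by omega)) (Or.inl h3) hET)
      have h4 := State.level_of_not_halted hh
      rcases tick_timers cfg r (ρ.state (t + i) r) (ρ.requests (t + i) r)
        (ρ.delivered (t + i) r) with ⟨h6, h7, -⟩ | ⟨h6, -⟩
      · rw [← add_assoc, state_succ' ρ _ hr]
        unfold progress
        omega
      · rw [← add_assoc, state_succ' ρ _ hr] at h4
        unfold progress at h4
        omega
  -- On the other hand the timer of `T` has expired by the end of this interval, so the level must
  -- have risen.
  have h1 := level_of_pending ρ hδ hr (T := T) (t := t) (w := (ρ.state t r).view)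
    (fun i hi => hpend _ (by omega) (by omega)) (by
      have := (key 0 (Nat.zero_le _)).1
      rw [add_zero] at this
      omega)
  have := (key _ le_rfl).1
  omega

/-- The log at time `t` was broadcast when it last changed or at the last multiple of `period`,
whichever is later; the clock of a replica equals the time. -/
theorem exists_checkpoint_sent (ρ : Run n Req F cfg) (hP : 0 < cfg.period) {q : Fin n}
    (hq : q ∉ F) {t : ℕ} (ht : cfg.period ≤ t) :
    ∃ s, t ≤ s + cfg.period ∧ s < t ∧
      ∀ r, (r, .checkpoint (ρ.state t q).log) ∈ (ρ.progress s q).out := by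
  have hsend : ∀ s, ((s + 1) % cfg.period = 0 ∨ (ρ.state (s + 1) q).log ≠ (ρ.state s q).log) →
      ∀ r, (r, .checkpoint (ρ.state (s + 1) q).log) ∈ (ρ.progress s q).out := by
    intro s hs r
    rw [state_succ' ρ s hq] at hs ⊢
    refine checkpoint_mem_tick_out _ _ _ _ _ ?_ r
    rw [clock_eq ρ s hq]
    exact hs
  have hdiv : cfg.period * (t / cfg.period) + t % cfg.period = t := Nat.div_add_mod t cfg.period
  have hmod : t % cfg.period < cfg.period := Nat.mod_lt _ hP
  have hpos : 0 < cfg.period * (t / cfg.period) := Nat.mul_pos hP (Nat.div_pos ht hP)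
  -- Induction from the last multiple of `period` up to `t`. The tick that produces the state at
  -- time `s + 1` is tick `s`, whence the shifts by one.
  have key : ∀ d, ∃ s, cfg.period * (t / cfg.period) ≤ s + 1 ∧
      s < cfg.period * (t / cfg.period) + d ∧ ∀ r, (r, .checkpoint
        (ρ.state (cfg.period * (t / cfg.period) + d) q).log) ∈ (ρ.progress s q).out := by
    intro d
    induction d with
    | zero =>
      obtain ⟨s, hs⟩ : ∃ s, cfg.period * (t / cfg.period) = s + 1 :=
        ⟨cfg.period * (t / cfg.period) - 1, by omega⟩
      refine ⟨s, by omega, by omega, ?_⟩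
      rw [add_zero, hs]
      exact hsend s (Or.inl (by rw [← hs]; exact Nat.mul_mod_right _ _))
    | succ d ih =>
      by_cases h : (ρ.state (cfg.period * (t / cfg.period) + d + 1) q).log =
          (ρ.state (cfg.period * (t / cfg.period) + d) q).log
      · obtain ⟨s, h1, h2, h3⟩ := ih
        refine ⟨s, h1, by omega, ?_⟩
        rw [← add_assoc, h]
        exact h3
      · exact ⟨cfg.period * (t / cfg.period) + d, by omega, by omega, hsend _ (Or.inr h)⟩
  obtain ⟨s, h1, h2, h3⟩ := key (t % cfg.period)
  rw [hdiv] at h2 h3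
  exact ⟨s, by omega, h2, h3⟩

/-- If some non-faulty replica does not execute `T`, then no non-faulty replica has `T` executed for
a long time. -/
theorem all_pending_of_not_executes (ρ : Run n Req F cfg) (hδ : 0 < cfg.δ) (hP : 0 < cfg.period)
    {Δ V a N b : ℕ} (hb : a + cfg.period + N + Δ + cfg.δ * 2 ^ (V + (cfg.period + N + Δ)) < b)
    (hrel : ρ.Reliable Δ a b) (hV : ∀ r ∉ F, (ρ.state a r).view ≤ V) {T : Req}
    (hk : ∀ r ∉ F, T ∈ (ρ.state a r).known) {r : Fin n} (hr : r ∉ F)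
    (hne : ¬ ρ.Executes r T a b) {q : Fin n} (hq : q ∉ F) {t : ℕ} (h1 : a + cfg.period ≤ t)
    (h2 : t ≤ a + cfg.period + N) : (ρ.state t q).pending T = true := by
  refine State.pending_iff.2 ⟨known_mono ρ hq (by omega) (hk q hq), ?_⟩
  by_contra hcon
  push Not at hcon
  obtain ⟨s, hs1, hs2, hs3⟩ := exists_checkpoint_sent ρ hP hq (t := t) (by omega)
  obtain ⟨t', ht1, ht2, ht3⟩ := hrel s (by omega) (by omega) q hq r hr _ (hs3 r)
  -- A crude bound: a level rises by at most 2 per tick, a view thus by at most one per tick on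
  -- balance. It only has to be independent of the run, as it enters `L` through the timeout.
  have hview : (ρ.state t' r).view ≤ V + (cfg.period + N + Δ) := by
    obtain ⟨d, rfl⟩ : ∃ d, t' = a + d := ⟨t' - a, by omega⟩
    have h3 := level_add_le ρ hr a d
    have h4 := hV r hr
    unfold State.level at h3
    split at h3 <;> split at h3 <;> omega
  exact hne (executes_of_delivered_checkpoint ρ hδ hr (hk r hr) (by omega) ht3
    (validLogs ρ t hq).1 hcon hview (by omega))

end Run


/-! ### Logs, slots and supports in ticks that end in a given view -/

section Views

variable {n : ℕ} [NeZero n] {Req : Type*} [DecidableEq Req]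

theorem level_entered_of_tick {cfg : Config} {me : Fin n} {s : State n Req} {reqs : List Req}
    {ms : List (Fin n × Msg n Req)} {u : ℕ} (h : (tick cfg me s reqs ms).st.level = 2 * u) :
    (entered cfg s reqs ms).st.level = 2 * u := by
  rcases tick_level cfg me s reqs ms with ⟨h1, -⟩ | ⟨h1, -⟩ <;> omega

/-- What happens in a tick that ends in view `u`. -/
theorem tick_in_view {cfg : Config} {me : Fin n} {s : State n Req} {reqs : List Req}
    {ms : List (Fin n × Msg n Req)} {u : ℕ} (h : (tick cfg me s reqs ms).st.level = 2 * u) :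
    (s.level = 2 * u ∧ (entered cfg s reqs ms).st.base = s.base ∧
      (entered cfg s reqs ms).st.log = s.log ∧
      (entered cfg s reqs ms).st.proposed = s.proposed ∧
      (entered cfg s reqs ms).st.certified = s.certified) ∨
    ((entered cfg s reqs ms).st.proposed = [] ∧ (entered cfg s reqs ms).st.certified = [] ∧
      ∃ vs, (primary n u, Msg.nvPropose u vs) ∈ s.inbox ++ ms ∧
        (entered cfg s reqs ms).st.base = (longestLog vs).length ∧
        (entered cfg s reqs ms).st.log = longestLog vs) := by
  have he := State.level_eq_even.1 (level_entered_of_tick h)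
  rcases entered_cases cfg s reqs ms with ⟨h1, h2, h3, h4, h5, h6, -⟩ |
    ⟨-, vs, h1, -, h2, h3, h4, h5, h6, h7⟩
  · rw [h1, h2] at he
    exact Or.inl ⟨State.level_eq_even.2 he, h3, h6 he.2, h4, h5⟩
  · obtain rfl : u = s.view + 1 := by rw [← he.1, h2]
    exact Or.inr ⟨h6, h7, vs, h1, h4, h5⟩

theorem seq_of_validLog {cfg : Config} {E : List (Cert n Req)} (h : validLog cfg E = true)
    {i : ℕ} {c : Cert n Req} (hc : E[i]? = some c) : c.seq = i := by
  simp only [validLog, Bool.and_eq_true, decide_eq_true_eq] at h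
  have h1 : (E.map Cert.seq)[i]? = some c.seq := by simp [hc]
  obtain ⟨hi, -⟩ := List.getElem?_eq_some_iff.1 hc
  rw [h.1, List.getElem?_range hi] at h1
  exact (Option.some.inj h1).symm

theorem nf_le_card {F S : Finset (Fin n)} {cfg : Config} (hf : cfg.f = F.card)
    (h : ∀ q ∉ F, q ∈ S) : cfg.nf n ≤ S.card := by
  have h1 : Fᶜ ⊆ S := fun q hq => h q (Finset.mem_compl.1 hq)
  have h2 := Finset.card_le_card h1
  rw [Finset.card_compl, Fintype.card_fin] at h2
  unfold Config.nf
  omega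

theorem mem_supported_tick {cfg : Config} {me : Fin n} {s : State n Req} {reqs : List Req}
    {ms : List (Fin n × Msg n Req)} {x : Req × ℕ × ℕ}
    (hx : x ∈ (tick cfg me s reqs ms).st.supported) : x ∈ s.supported ∨
      (primary n x.2.1, Msg.propose x.1 x.2.1 x.2.2) ∈ s.inbox ++ ms ∧
      (primary n x.2.1, Msg.support x.1 x.2.1 x.2.2) ∈ (tick cfg me s reqs ms).out := by
  obtain ⟨S, o, h1, h2, -⟩ := supportProposals_shape (entered cfg s reqs ms)
  rw [(tick_frame cfg me s reqs ms).2.2.2.1, h1] at hx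
  simp only [entered_frame] at h2 hx
  rcases List.mem_append.1 hx with h | h
  · exact Or.inl h
  · obtain ⟨e1, e2, -, e3⟩ := h2 x h
    rw [e2]
    rw [e2] at e1 e3
    refine Or.inr ⟨e1, normalCase_out_subset_tick _ _ _ _ _
      (supportProposals_out_subset_normalCase _ _ _ ?_)⟩
    rw [h1]
    exact List.mem_append_right _ e3

theorem supported_subset_tick (cfg : Config) (me : Fin n) (s : State n Req) (reqs : List Req)
    (ms : List (Fin n × Msg n Req)) :
    s.supported ⊆ (tick cfg me s reqs ms).st.supported := by
  obtain ⟨S, o, h1, -⟩ := supportProposals_shape (entered cfg s reqs ms)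
  rw [(tick_frame cfg me s reqs ms).2.2.2.1, h1]
  simp

end Views

/-! ### Views with a non-faulty primary -/

namespace Run

variable {n : ℕ} [NeZero n] {Req : Type*} [DecidableEq Req] {F : Finset (Fin n)} {cfg : Config}

theorem supported_mono (ρ : Run n Req F cfg) {r : Fin n} (hr : r ∉ F) {s t : ℕ} (h : s ≤ t) :
    (ρ.state s r).supported ⊆ (ρ.state t r).supported := by
  induction t, h using Nat.le_induction with
  | base => exact List.Subset.refl _
  | succ t _ ih =>
    rw [state_succ' ρ t hr]
    exact List.Subset.trans ih (supported_subset_tick ..)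

/-- Every new-view proposal strictly increases `lastNewView` to the proposed view, so a view is
proposed in one tick only, with one content. -/
theorem nvPropose_unique (ρ : Run n Req F cfg) {p : Fin n} (hp : p ∉ F) {u : ℕ} {s s' : ℕ}
    {d d' : Fin n} {vs vs' : List (VcRequest n Req)}
    (h : (d, Msg.nvPropose u vs) ∈ (ρ.progress s p).out)
    (h' : (d', Msg.nvPropose u vs') ∈ (ρ.progress s' p).out) : vs' = vs := by
  obtain ⟨h1, h2, -, h3⟩ := nvPropose_mem_tick_out h
  obtain ⟨h1', h2', -, -⟩ := nvPropose_mem_tick_out h'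
  change (ρ.progress s p).st.lastNewView = u at h2
  change (ρ.progress s' p).st.lastNewView = u at h2'
  rw [← state_succ' ρ _ hp] at h2 h2'
  rcases lt_trichotomy s s' with hs | rfl | hs
  · have := lastNewView_mono ρ hp (show s + 1 ≤ s' by omega)
    omega
  · exact h3 _ _ _ h'
  · have := lastNewView_mono ρ hp (show s' + 1 ≤ s by omega)
    omega

/-! ### Replicas in a view with a non-faulty primary -/

/-- Views `u > 0` can only be entered through a new-view proposal, which here the non-faulty primary
really sent. From then on the log only grows, by transactions supported in this view at their own
sequence number. The log below `base` plays no role later. -/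
theorem backup_invariant (ρ : Run n Req F cfg) {u : ℕ} (hu : 0 < u) (hp : primary n u ∉ F)
    {q : Fin n} (hq : q ∉ F) {t : ℕ} (ht : (ρ.state t q).level = 2 * u) :
    (∃ vs, (∃ s < t, ∃ d, (d, Msg.nvPropose u vs) ∈ (ρ.progress s (primary n u)).out) ∧
      (ρ.state t q).base = (longestLog vs).length) ∧
    (ρ.state t q).base ≤ (ρ.state t q).log.length ∧
    ∀ i c, (ρ.state t q).base ≤ i → (ρ.state t q).log[i]? = some c →
      (c.req, u, i) ∈ (ρ.state t q).supported := by
  induction t with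
  | zero =>
    rw [ρ.state_zero q hq] at ht
    simp [State.level, State.init] at ht
    omega
  | succ t ih =>
    have hvalid := (validLogs ρ (t + 1) hq).1
    have hinbox := fun m => sent_of_mem_inbox ρ (t := t + 1) (m := m) hq hp
    rw [inbox_succ ρ t hq] at hinbox
    rw [state_succ' ρ t hq] at ht hvalid ⊢
    unfold progress at ht hvalid ⊢
    obtain ⟨l, hl, hl'⟩ := execute_shape cfg
      (supportProposals (entered cfg (ρ.state t q) (ρ.requests t q) (ρ.delivered t q)))
    have hlog : (tick cfg q (ρ.state t q) (ρ.requests t q) (ρ.delivered t q)).st.log =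
        (entered cfg (ρ.state t q) (ρ.requests t q) (ρ.delivered t q)).st.log ++ l := by
      rw [(tick_frame _ _ _ _ _).1, hl]
      simp
    have hview := (State.level_eq_even.1 (level_entered_of_tick ht)).1
    have hnew : ∀ i c,
        (entered cfg (ρ.state t q) (ρ.requests t q) (ρ.delivered t q)).st.log.length ≤ i →
        (tick cfg q (ρ.state t q) (ρ.requests t q) (ρ.delivered t q)).st.log[i]? = some c →
        (c.req, u, i) ∈
          (tick cfg q (ρ.state t q) (ρ.requests t q) (ρ.delivered t q)).st.supported := by
      intro i c hi hc
      have hseq := seq_of_validLog hvalid hc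
      rw [hlog, List.getElem?_append_right hi] at hc
      obtain ⟨-, p, hp⟩ := hl' c (List.mem_of_getElem? hc)
      obtain ⟨⟨-, e1, e2⟩, -⟩ := viewCommits_iff.1 hp
      simp only [supportProposals_frame] at e1
      rw [e1, hview, hseq] at e2
      rw [(tick_frame _ _ _ _ _).2.2.2.1]
      exact e2
    rcases tick_in_view ht with ⟨h1, h2, h3, -⟩ | ⟨-, -, vs, h1, h2, h3⟩
    · obtain ⟨⟨vs, ⟨s, hs, d, hd⟩, hbase⟩, hlen, hsup⟩ := ih h1
      rw [(tick_frame _ _ _ _ _).2.2.2.2.1, h2]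
      refine ⟨⟨vs, ⟨s, by omega, d, hd⟩, hbase⟩, ?_, ?_⟩
      · rw [hlog, h3, List.length_append]
        omega
      · intro i c hi hc
        by_cases hi' : (ρ.state t q).log.length ≤ i
        · exact hnew i c (by rwa [h3]) hc
        · rw [hlog, h3, List.getElem?_append_left (by omega)] at hc
          exact supported_subset_tick _ _ _ _ _ (hsup i c hi hc)
    · obtain ⟨s, hs, hd⟩ := hinbox _ h1
      rw [(tick_frame _ _ _ _ _).2.2.2.2.1, h2]
      refine ⟨⟨vs, ⟨s, by omega, q, hd⟩, rfl⟩, ?_, ?_⟩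
      · rw [hlog, h3, List.length_append]
        omega
      · intro i c hi hc
        exact hnew i c (by rwa [h3]) hc

/-- All replicas entered through the same proposal, so the slots of the primary and of the backups
are numbered alike. -/
theorem base_eq (ρ : Run n Req F cfg) {u : ℕ} (hu : 0 < u) (hp : primary n u ∉ F)
    {q q' : Fin n} (hq : q ∉ F) (hq' : q' ∉ F) {t t' : ℕ} (ht : (ρ.state t q).level = 2 * u)
    (ht' : (ρ.state t' q').level = 2 * u) : (ρ.state t q).base = (ρ.state t' q').base := by
  obtain ⟨⟨vs, ⟨s, -, d, hd⟩, h⟩, -⟩ := backup_invariant ρ hu hp hq ht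
  obtain ⟨⟨vs', ⟨s', -, d', hd'⟩, h'⟩, -⟩ := backup_invariant ρ hu hp hq' ht'
  rw [h, h', nvPropose_unique ρ hp hd hd']

/-- The lists of proposed and certified slots are backed by actual broadcasts. The bound on the
level at time `s + 1` serves to place these broadcasts inside the reliable period. -/
theorem primary_invariant (ρ : Run n Req F cfg) {u : ℕ} (hu : 0 < u) {p : Fin n} (hp : p ∉ F)
    {t : ℕ} (ht : (ρ.state t p).level = 2 * u) :
    (∀ i T, (ρ.state t p).proposed[i]? = some T → ∃ s < t, 2 * u ≤ (ρ.state (s + 1) p).level ∧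
      ∀ r, (r, Msg.propose T u ((ρ.state t p).base + i)) ∈ (ρ.progress s p).out) ∧
    (∀ k ∈ (ρ.state t p).certified, ∃ i T S, k = (ρ.state t p).base + i ∧
      (ρ.state t p).proposed[i]? = some T ∧ cfg.nf n ≤ S.card ∧
      ∃ s < t, 2 * u ≤ (ρ.state (s + 1) p).level ∧
      ∀ r, (r, Msg.certify ⟨T, u, k, S⟩) ∈ (ρ.progress s p).out) := by
  induction t with
  | zero =>
    rw [ρ.state_zero p hp] at ht
    simp [State.level, State.init] at ht
    omega
  | succ t ih =>
    have hlev := ht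
    rw [state_succ' ρ t hp] at ht ⊢
    unfold progress at ht ⊢
    have hview := (State.level_eq_even.1 (level_entered_of_tick ht)).1
    obtain ⟨l, o, h1, h2, -⟩ := proposeRequests_shape p (execute cfg
      (supportProposals (entered cfg (ρ.state t p) (ρ.requests t p) (ρ.delivered t p))))
    have hprop : (tick cfg p (ρ.state t p) (ρ.requests t p) (ρ.delivered t p)).st.proposed =
        (entered cfg (ρ.state t p) (ρ.requests t p) (ρ.delivered t p)).st.proposed ++ l := by
      rw [(tick_frame _ _ _ _ _).2.2.2.2.2.1, h1]
      simp
    have hbase := (tick_frame cfg p (ρ.state t p) (ρ.requests t p) (ρ.delivered t p)).2.2.2.2.1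
    simp only [execute_frame, supportProposals_frame, hview] at h2
    have hnew : ∀ i T,
        (entered cfg (ρ.state t p) (ρ.requests t p) (ρ.delivered t p)).st.proposed.length ≤ i →
        (tick cfg p (ρ.state t p) (ρ.requests t p) (ρ.delivered t p)).st.proposed[i]? = some T →
        ∀ r, (r, Msg.propose T u ((tick cfg p (ρ.state t p) (ρ.requests t p)
          (ρ.delivered t p)).st.base + i)) ∈
          (tick cfg p (ρ.state t p) (ρ.requests t p) (ρ.delivered t p)).out := by
      intro i T hi hT r
      rw [hprop, List.getElem?_append_right hi] at hT
      have := h2 _ T hT r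
      rw [Nat.add_sub_cancel' hi] at this
      rw [hbase]
      refine normalCase_out_subset_tick _ _ _ _ _ (proposeRequests_out_subset_normalCase _ _ _ ?_)
      rw [h1]
      exact List.mem_append_right _ this
    obtain ⟨l', o', h1', h2', -⟩ := certifyProposals_shape cfg p (proposeRequests p (execute cfg
      (supportProposals (entered cfg (ρ.state t p) (ρ.requests t p) (ρ.delivered t p)))))
    have hcert : (tick cfg p (ρ.state t p) (ρ.requests t p) (ρ.delivered t p)).st.certified =
        (entered cfg (ρ.state t p) (ρ.requests t p) (ρ.delivered t p)).st.certified ++ l' := by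
      rw [(tick_frame _ _ _ _ _).2.2.2.2.2.2.1, normalCase, h1']
      simp
    have hout' : o' ⊆ (tick cfg p (ρ.state t p) (ρ.requests t p) (ρ.delivered t p)).out := by
      refine List.Subset.trans ?_ (normalCase_out_subset_tick _ _ _ _ _)
      rw [normalCase, h1']
      exact List.subset_append_right _ _
    simp only [proposeRequests_frame, execute_frame, supportProposals_frame, hview] at h2'
    rw [← (tick_frame cfg p (ρ.state t p) (ρ.requests t p) (ρ.delivered t p)).2.2.2.2.2.1,
      ← hbase] at h2'
    have hnew' : ∀ k ∈ l', ∃ i T S,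
        k = (tick cfg p (ρ.state t p) (ρ.requests t p) (ρ.delivered t p)).st.base + i ∧
        (tick cfg p (ρ.state t p) (ρ.requests t p) (ρ.delivered t p)).st.proposed[i]? = some T ∧
        cfg.nf n ≤ S.card ∧ ∃ s < t + 1, 2 * u ≤ (ρ.state (s + 1) p).level ∧
        ∀ r, (r, Msg.certify ⟨T, u, k, S⟩) ∈
          (tick cfg p (ρ.state s p) (ρ.requests s p) (ρ.delivered s p)).out := by
      intro k hk
      obtain ⟨i, T, S, e1, e2, e3, e4⟩ := h2' k hk
      exact ⟨i, T, S, e1, e2, e3, t, by omega, hlev.ge, fun r => hout' (e4 r)⟩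
    rcases tick_in_view ht with ⟨e1, e2, -, e3, e4⟩ | ⟨e1, e2, -⟩
    · obtain ⟨ih1, ih2⟩ := ih e1
      rw [e3] at hprop hnew
      rw [e4] at hcert
      rw [e2] at hbase
      constructor
      · intro i T hT
        by_cases hi : (ρ.state t p).proposed.length ≤ i
        · exact ⟨t, by omega, hlev.ge, hnew i T hi hT⟩
        · rw [hprop, List.getElem?_append_left (by omega)] at hT
          obtain ⟨s, hs, h⟩ := ih1 i T hT
          rw [hbase]
          exact ⟨s, by omega, h⟩
      · intro k hk
        rw [hcert] at hk
        rcases List.mem_append.1 hk with hk | hk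
        · obtain ⟨i, T, S, f1, f2, f3, s, hs, f4⟩ := ih2 k hk
          refine ⟨i, T, S, by rw [hbase, f1], ?_, f3, s, by omega, f4⟩
          rw [hprop, List.getElem?_append_left (List.getElem?_eq_some_iff.1 f2).1, f2]
        · exact hnew' k hk
    · rw [e1] at hprop hnew
      rw [e2, List.nil_append] at hcert
      constructor
      · intro i T hT
        exact ⟨t, by omega, hlev.ge, hnew i T (Nat.zero_le _) hT⟩
      · intro k hk
        rw [hcert] at hk
        exact hnew' k hk

/-- Levels are monotone, so the replica is in view `u` throughout and never re-enters it; only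
entering a view resets `base` and `proposed`. -/
theorem proposed_persists (ρ : Run n Req F cfg) {u : ℕ} {p : Fin n} (hp : p ∉ F) {t t' : ℕ}
    (htt : t ≤ t') (ht : (ρ.state t p).level = 2 * u) (ht' : (ρ.state t' p).level = 2 * u) {i : ℕ}
    {T : Req} (hT : (ρ.state t p).proposed[i]? = some T) :
    (ρ.state t' p).base = (ρ.state t p).base ∧ (ρ.state t' p).proposed[i]? = some T := by
  induction t', htt using Nat.le_induction with
  | base => exact ⟨rfl, hT⟩
  | succ t' htt ih =>
    have h1 : (ρ.state t' p).level = 2 * u := by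
      have := level_mono ρ hp htt
      have := level_mono ρ hp (show t' ≤ t' + 1 by omega)
      omega
    obtain ⟨ih1, ih2⟩ := ih h1
    rw [state_succ' ρ t' hp] at ht' ⊢
    unfold progress at ht' ⊢
    obtain ⟨e1, e2⟩ := State.level_eq_even.1 h1
    rcases entered_cases cfg (ρ.state t' p) (ρ.requests t' p) (ρ.delivered t' p) with
      ⟨-, -, h3, h4, -⟩ | ⟨h, -⟩
    · rw [(tick_frame _ _ _ _ _).2.2.2.2.1, (tick_frame _ _ _ _ _).2.2.2.2.2.1, h3]
      refine ⟨ih1, ?_⟩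
      obtain ⟨l, o, h5, -⟩ := proposeRequests_shape p (execute cfg
        (supportProposals (entered cfg (ρ.state t' p) (ρ.requests t' p) (ρ.delivered t' p))))
      rw [h5]
      simp only [execute_frame, supportProposals_frame, h4]
      rw [List.getElem?_append_left (List.getElem?_eq_some_iff.1 ih2).1, ih2]
    · simp [e2] at h

theorem proposed_of_sent (ρ : Run n Req F cfg) {u : ℕ} {p : Fin n} (hp : p ∉ F) {s t : ℕ}
    (hst : s < t) (ht : (ρ.state t p).level = 2 * u) {d : Fin n} {T : Req} {k : ℕ}
    (h : (d, Msg.propose T u k) ∈ (ρ.progress s p).out) :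
    ∃ i, (ρ.state t p).proposed[i]? = some T ∧ k = (ρ.state t p).base + i := by
  obtain ⟨h1, i, h2, h3⟩ := propose_mem_tick_out h
  have h4 : (ρ.state (s + 1) p).level = 2 * u := by
    have := level_mono ρ hp (show s + 1 ≤ t by omega)
    have h5 : 2 * u ≤ (ρ.state (s + 1) p).level := by
      rw [state_succ' ρ s hp]
      unfold progress
      rcases tick_level cfg p (ρ.state s p) (ρ.requests s p) (ρ.delivered s p) with
        ⟨h, -⟩ | ⟨h, -⟩ <;> omega
    omega
  change (ρ.progress s p).st.proposed[i]? = some T at h2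
  change k = (ρ.progress s p).st.base + i at h3
  rw [← state_succ' ρ s hp] at h2 h3
  obtain ⟨h5, h6⟩ := proposed_persists ρ hp (show s + 1 ≤ t by omega) h4 ht h2
  exact ⟨i, h6, by rw [h5, h3]⟩

theorem sent_of_supported (ρ : Run n Req F cfg) {u : ℕ} (hp : primary n u ∉ F) {q : Fin n}
    (hq : q ∉ F) {t : ℕ} {T : Req} {k : ℕ} (h : (T, u, k) ∈ (ρ.state t q).supported) :
    (∃ s < t, 2 * u ≤ (ρ.state (s + 1) q).level ∧
      (primary n u, Msg.support T u k) ∈ (ρ.progress s q).out) ∧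
    ∃ s < t, (q, Msg.propose T u k) ∈ (ρ.progress s (primary n u)).out := by
  induction t with
  | zero => simp [ρ.state_zero q hq, State.init] at h
  | succ t ih =>
    have hinbox := fun m => sent_of_mem_inbox ρ (t := t + 1) (m := m) hq hp
    rw [inbox_succ ρ t hq] at hinbox
    rw [state_succ' ρ t hq] at h
    rcases mem_supported_tick h with h | ⟨h1, h2⟩
    · obtain ⟨⟨s, hs, h1⟩, ⟨s', hs', h2⟩⟩ := ih h
      exact ⟨⟨s, by omega, h1⟩, s', by omega, h2⟩
    · obtain ⟨s, hs, h3⟩ := hinbox _ h1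
      refine ⟨⟨t, by omega, ?_, h2⟩, s, by omega, h3⟩
      have h4 := support_mem_tick_out h2
      rw [state_succ' ρ t hq]
      unfold progress
      rcases tick_level cfg q (ρ.state t q) (ρ.requests t q) (ρ.delivered t q) with
        ⟨h, -⟩ | ⟨h, -⟩ <;> simp only at h4 <;> omega

/-- In a view with a non-faulty primary, only what the primary proposes is supported. -/
theorem proposed_of_supported (ρ : Run n Req F cfg) {u : ℕ} (hu : 0 < u) (hp : primary n u ∉ F)
    {q : Fin n} (hq : q ∉ F) {t t' : ℕ} (ht : (ρ.state t (primary n u)).level = 2 * u)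
    (ht' : (ρ.state t' (primary n u)).level = 2 * u) {T T' : Req} {i : ℕ}
    (h : (ρ.state t (primary n u)).proposed[i]? = some T)
    (hs : (T', u, (ρ.state t (primary n u)).base + i) ∈ (ρ.state t' q).supported) : T' = T := by
  obtain ⟨-, s, hs, h1⟩ := sent_of_supported ρ hp hq hs
  obtain ⟨i', h2, h3⟩ := proposed_of_sent ρ hp hs ht' h1
  have hb := base_eq ρ hu hp hp hp ht ht'
  obtain rfl : i = i' := by omega
  -- The list of proposals only grows while the view lasts, so both entries can be compared at the
  -- later time.
  rcases le_total t t' with htt | htt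
  · have := (proposed_persists ρ hp htt ht ht' h).2
    rw [h2] at this
    exact Option.some.inj this
  · have := (proposed_persists ρ hp htt ht' ht h2).2
    rw [h] at this
    exact (Option.some.inj this).symm

/-! ### The change to a view with a non-faulty primary -/

/-- Level `2 * w + 1` cannot be jumped over: in the tick in which it is first reached or passed, the
replica requests a view-change for view `w` itself. -/
theorem exists_vcRequest (ρ : Run n Req F cfg) {q : Fin n} (hq : q ∉ F) {w a t : ℕ} (hat : a ≤ t)
    (ha : (ρ.state a q).level ≤ 2 * w) (ht : 2 * w + 1 ≤ (ρ.state t q).level) :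
    ∃ s, a ≤ s ∧ s < t ∧ ∃ E, validLog cfg E = true ∧
      ∀ r, (r, Msg.vcRequest ⟨q, w, E⟩) ∈ (ρ.progress s q).out := by
  induction t, hat using Nat.le_induction with
  | base => omega
  | succ t hat ih =>
    by_cases h : 2 * w + 1 ≤ (ρ.state t q).level
    · obtain ⟨s, h1, h2, h3⟩ := ih h
      exact ⟨s, h1, by omega, h3⟩
    · have hvalid := (validLogs ρ (t + 1) hq).1
      rw [state_succ' ρ t hq] at ht hvalid
      unfold progress at ht
      rcases tick_timers cfg q (ρ.state t q) (ρ.requests t q) (ρ.delivered t q) with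
        ⟨-, h1, -⟩ | ⟨h1, -, -, h2⟩
      · omega
      · have h3 : ((ρ.state t q).level + 1) / 2 = w := by omega
        rw [h3] at h2
        exact ⟨t, hat, by omega, _, hvalid, h2⟩

theorem nvPropose_of_lastNewView_lt (ρ : Run n Req F cfg) {p : Fin n} (hp : p ∉ F) {u t : ℕ}
    (h1 : (ρ.state t p).lastNewView < u) (h2 : u ≤ (ρ.state (t + 1) p).lastNewView)
    (h3 : (ρ.state (t + 1) p).lastNewView ≤ u) :
    ∃ vs, ∀ r, (r, Msg.nvPropose u vs) ∈ (ρ.progress t p).out := by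
  rw [state_succ' ρ t hp] at h2 h3
  unfold progress at h2 h3
  rcases lastNewView_tick cfg p (ρ.state t p) (ρ.requests t p) (ρ.delivered t p) with
    ⟨h, -⟩ | ⟨-, h, vs, h4⟩
  · omega
  · have : (tick cfg p (ρ.state t p) (ρ.requests t p) (ρ.delivered t p)).st.view + 1 = u := by
      omega
    rw [this] at h4
    exact ⟨vs, h4⟩

/-- By time `X + Δ` the requests of all non-faulty replicas for view `u - 1` have arrived at the
next primary, and these are a quorum. The margin 4 in `hlow` means that at time `a` no view exceeds
`u - 2`, so everything that concerns the change to view `u` is sent from `a` on and is delivered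
reliably. -/
theorem exists_nvPropose (ρ : Run n Req F cfg) (hf : cfg.f = F.card) {Δ a b : ℕ}
    (hrel : ρ.Reliable Δ a b) {u X : ℕ} (hu : 0 < u) (hp : primary n u ∉ F)
    (hlow : ∀ q ∉ F, (ρ.state a q).level + 4 ≤ 2 * u)
    (hX : ∀ q ∉ F, 2 * u ≤ (ρ.state X q).level + 1)
    (hhigh : (ρ.state (X + Δ + 1) (primary n u)).level ≤ 2 * u) (hXb : X + Δ ≤ b) :
    ∃ s vs, a ≤ s ∧ s ≤ X + Δ ∧
      ∀ r, (r, Msg.nvPropose u vs) ∈ (ρ.progress s (primary n u)).out := by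
  set p := primary n u with hpu
  have haX : a ≤ X := by
    by_contra h
    have := level_mono ρ hp (show X ≤ a by omega)
    have := hlow p hp
    have := hX p hp
    omega
  have hlast : (ρ.state a p).lastNewView < u := by
    have h1 := lastNewView_le ρ a hp
    have h2 := hlow p hp
    unfold State.level at h2
    split at h2 <;> omega
  have hlev := hX p hp
  have hmono := level_mono ρ hp (show X ≤ X + Δ + 1 by omega)
  -- Either the new primary is still halted in view `u - 1` and has had to propose, or it is already
  -- in view `u`, which it can only have entered through its own proposal.
  rcases Nat.lt_or_ge (ρ.state (X + Δ + 1) p).level (2 * u) with hlt | hge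
  · have hlevel : (ρ.state (X + Δ + 1) p).level = 2 * (u - 1) + 1 := by omega
    obtain ⟨hview, hh⟩ := State.level_eq_odd.1 hlevel
    have hle : ∀ t ≤ X + Δ + 1, (ρ.state t p).lastNewView ≤ u := by
      intro t ht
      have h1 := lastNewView_mono ρ hp ht
      have h2 := lastNewView_le ρ (X + Δ + 1) hp
      omega
    have hfin : u ≤ (ρ.state (X + Δ + 1) p).lastNewView := by
      have hinbox : ∀ q ∉ F, ∃ E, validLog cfg E = true ∧
          (q, Msg.vcRequest ⟨q, u - 1, E⟩) ∈ (ρ.state (X + Δ + 1) p).inbox := by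
        intro q hq
        have h1 := hlow q hq
        have h2 := hX q hq
        obtain ⟨s, hs1, hs2, E, hE, hs3⟩ := exists_vcRequest ρ hq haX (w := u - 1)
          (by omega) (by omega)
        exact ⟨E, hE, hrel.mem_inbox hs1 (by omega) hq hp (hs3 p) (by omega)⟩
      have hcount : cfg.nf n ≤ ((List.finRange n).filterMap
          (firstVcRequest cfg (ρ.state (X + Δ + 1) p) (u - 1))).length := by
        rw [List.length_filterMap_eq_countP, List.countP_eq_length_filter]
        refine le_trans (nf_le_card hf ?_) (List.toFinset_card_le _)
        intro q hq
        rw [List.mem_toFinset, List.mem_filter]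
        refine ⟨List.mem_finRange q, ?_⟩
        obtain ⟨E, hE, hmem⟩ := hinbox q hq
        rw [Option.isSome_iff_ne_none]
        intro hnone
        have := List.findSome?_eq_none_iff.1 hnone _ hmem
        simp [hE] at this
      rw [state_succ' ρ _ hp] at hcount hview ⊢
      unfold progress at hcount hview ⊢
      rcases lastNewView_tick cfg p (ρ.state (X + Δ) p) (ρ.requests (X + Δ) p)
        (ρ.delivered (X + Δ) p) with ⟨h1, h2⟩ | ⟨-, h, -⟩
      · rw [h1]
        by_contra hcon
        rw [hview, Nat.sub_add_cancel hu] at h2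
        have := h2 hpu (by omega)
        omega
      · omega
    -- Locates the tick in which `lastNewView` passes to `u`: this is when the proposal was
    -- broadcast.
    have hcross : ∀ t, a ≤ t → t ≤ X + Δ + 1 → u ≤ (ρ.state t p).lastNewView →
        ∃ s, a ≤ s ∧ s < t ∧ (ρ.state s p).lastNewView < u ∧
          u ≤ (ρ.state (s + 1) p).lastNewView := by
      intro t hat
      induction t, hat using Nat.le_induction with
      | base => intro _ h; omega
      | succ t hat ih =>
        intro h1 h2
        by_cases h3 : u ≤ (ρ.state t p).lastNewView
        · obtain ⟨s, e1, e2, e3⟩ := ih (by omega) h3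
          exact ⟨s, e1, by omega, e3⟩
        · exact ⟨t, hat, by omega, by omega, h2⟩
    obtain ⟨s, e1, e2, e3, e4⟩ := hcross (X + Δ + 1) (by omega) le_rfl hfin
    obtain ⟨vs, h⟩ := nvPropose_of_lastNewView_lt ρ hp e3 e4 (hle _ (by omega))
    exact ⟨s, vs, e1, by omega, h⟩
  · obtain ⟨⟨vs, ⟨s, hs, d, hd⟩, -⟩, -⟩ := backup_invariant ρ hu hp hp
      (t := X + Δ + 1) (by omega)
    obtain ⟨h1, h2, -⟩ := nvPropose_mem_tick_out hd
    change (ρ.progress s p).st.lastNewView = u at h2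
    rw [← state_succ' ρ s hp] at h2
    -- The invariant provides one recipient only; the jump of `lastNewView` in this tick shows that
    -- the proposal went to everybody.
    obtain ⟨vs', h⟩ := nvPropose_of_lastNewView_lt ρ hp h1 h2.ge h2.le
    refine ⟨s, vs', ?_, by omega, h⟩
    by_contra hcon
    have := lastNewView_mono ρ hp (show s + 1 ≤ a by omega)
    omega

/-- A replica at level `2 * u - 1` waits for exactly this proposal. The conclusion is only a lower
bound, since the replica may request the next view-change in the same tick. -/
theorem level_eq_of_nvPropose (ρ : Run n Req F cfg) {u t : ℕ} (hu : 0 < u) {q : Fin n}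
    (hq : q ∉ F) {vs : List (VcRequest n Req)} (hvs : validNewView cfg u vs = true)
    (hin : (primary n u, Msg.nvPropose u vs) ∈ (ρ.state t q).inbox)
    (hlow : 2 * u ≤ (ρ.state t q).level + 1) : 2 * u ≤ (ρ.state (t + 1) q).level := by
  by_cases h : 2 * u ≤ (ρ.state t q).level
  · exact h.trans (level_mono ρ hq (by omega))
  have hlevel : (ρ.state t q).level = 2 * (u - 1) + 1 := by omega
  obtain ⟨hview, hh⟩ := State.level_eq_odd.1 hlevel
  have he : (entered cfg (ρ.state t q) (ρ.requests t q) (ρ.delivered t q)).st.level = 2 * u := by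
    rcases entered_cases cfg (ρ.state t q) (ρ.requests t q) (ρ.delivered t q) with
      ⟨-, -, -, -, -, -, h1⟩ | ⟨-, -, -, -, h1, h2, -⟩
    · have := h1 hh vs
      rw [hview, Nat.sub_add_cancel hu, hvs] at this
      exact absurd (this (List.mem_append_left _ hin)) (by simp)
    · rw [State.level_of_not_halted h2, h1, hview, Nat.sub_add_cancel hu]
  rw [state_succ' ρ t hq]
  unfold progress
  rcases tick_level cfg q (ρ.state t q) (ρ.requests t q) (ρ.delivered t q) with
    ⟨h, -⟩ | ⟨h, -⟩ <;> omega

/-- If the non-faulty replicas spend enough time together in a view with a non-faulty primary, then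
they execute the waiting requests. -/
theorem not_pending_of_view (ρ : Run n Req F cfg) (hf : cfg.f = F.card) {Δ a b : ℕ}
    (hrel : ρ.Reliable Δ a b) {u X : ℕ} (hu : 0 < u) (hp : primary n u ∉ F)
    (hlow : ∀ q ∉ F, (ρ.state a q).level + 4 ≤ 2 * u)
    (hX : ∀ q ∉ F, 2 * u ≤ (ρ.state X q).level + 1)
    (hhigh : ∀ q ∉ F, (ρ.state (X + 5 * Δ + 6) q).level ≤ 2 * u) (hb : X + 5 * Δ + 6 ≤ b)
    {T : Req} (hT : ∀ t, X ≤ t → t ≤ X + 5 * Δ + 6 →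
      (ρ.state t (primary n u)).pending T = true) : False := by
  have hhigh' : ∀ q ∉ F, ∀ t ≤ X + 5 * Δ + 6, (ρ.state t q).level ≤ 2 * u :=
    fun q hq t ht => (level_mono ρ hq ht).trans (hhigh q hq)
  -- Whatever is sent in a tick that ends at level at least `2 * u` is sent in the reliable period,
  -- because all levels are lower at time `a`.
  have hsent : ∀ q ∉ F, ∀ s, 2 * u ≤ (ρ.state (s + 1) q).level → a ≤ s := by
    intro q hq s hs
    by_contra hcon
    have := level_mono ρ hq (show s + 1 ≤ a by omega)
    have := hlow q hq
    omega
  obtain ⟨s, vs, hs1, hs2, hs3⟩ := exists_nvPropose ρ hf hrel hu hp hlow hX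
    (hhigh' _ hp _ (by omega)) (by omega)
  -- The new-view proposal is sent by `X + Δ`, is in every inbox at `X + 2 * Δ + 1`, and is acted
  -- upon in that tick. From then on the three phases of the normal case fit before `X + 5 * Δ + 6`,
  -- while nobody leaves the view.
  have hlev : ∀ q ∉ F, ∀ t, X + 2 * Δ + 2 ≤ t → t ≤ X + 5 * Δ + 6 →
      (ρ.state t q).level = 2 * u := by
    intro q hq t h1 h2
    have h3 : 2 * u ≤ (ρ.state (X + 2 * Δ + 2) q).level :=
      level_eq_of_nvPropose ρ hu hq (nvPropose_mem_tick_out (hs3 q)).2.2.1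
        (hrel.mem_inbox hs1 (by omega) hp hq (hs3 q) (by omega)) (by
          have := hX q hq
          have := level_mono ρ hq (show X ≤ X + 2 * Δ + 1 by omega)
          omega)
    have := level_mono ρ hq h1
    have := hhigh' q hq t h2
    omega
  set p := primary n u with hpu
  -- the primary proposes `T`
  obtain ⟨Z, hZ⟩ : ∃ Z, Z = X + 2 * Δ + 3 := ⟨_, rfl⟩
  have hTZ : T ∈ (ρ.state Z p).proposed := by
    have h1 := hT Z (by omega) (by omega)
    have h2 := hlev p hp Z (by omega) (by omega)
    obtain rfl : Z = X + 2 * Δ + 2 + 1 := by omega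
    rw [state_succ' ρ _ hp] at h1 h2 ⊢
    unfold progress at h1 h2 ⊢
    obtain ⟨e1, e2⟩ := State.level_eq_even.1 (level_entered_of_tick h2)
    obtain ⟨e3, e4⟩ := State.pending_iff.1 h1
    rw [(tick_frame _ _ _ _ _).2.1] at e3
    rw [(tick_frame _ _ _ _ _).1] at e4
    rw [(tick_frame _ _ _ _ _).2.2.2.2.2.1]
    exact mem_proposeRequests (by simpa using e2)
      (by simp only [execute_frame, supportProposals_frame, e1]; exact hpu) (by simpa using e3)
      (State.pending_iff.2 ⟨by simpa using e3, e4⟩)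
  obtain ⟨j, hj⟩ := List.getElem?_of_mem hTZ
  have hjlt : j < (ρ.state Z p).proposed.length := (List.getElem?_eq_some_iff.1 hj).1
  have hZp := hlev p hp Z (by omega) (by omega)
  have hbase : ∀ q ∉ F, ∀ t, X + 2 * Δ + 2 ≤ t → t ≤ X + 5 * Δ + 6 →
      (ρ.state t q).base = (ρ.state Z p).base :=
    fun q hq t h1 h2 => base_eq ρ hu hp hq hp (hlev q hq t h1 h2) hZp
  -- the replicas support the proposals
  have hsup : ∀ q ∉ F, ∀ i T', (ρ.state Z p).proposed[i]? = some T' →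
      (T', u, (ρ.state Z p).base + i) ∈ (ρ.state (Z + Δ + 1) q).supported := by
    intro q hq i T' hi
    obtain ⟨s, h1, h2, h3⟩ := (primary_invariant ρ hu hp hZp).1 i T' hi
    have h4 := hrel.mem_inbox (hsent p hp s h2) (by omega) hp hq (h3 q)
      (show s + Δ < Z + Δ by omega)
    have h5 := hlev q hq (Z + Δ + 1) (by omega) (by omega)
    have h6 := hbase q hq (Z + Δ + 1) (by omega) (by omega)
    -- The rule only guarantees that something is supported in this slot; that it is `T'` follows
    -- because the primary proposes nothing else there.
    have hex : ∃ T'', (T'', u, (ρ.state Z p).base + i) ∈ (ρ.state (Z + Δ + 1) q).supported := by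
      rw [state_succ' ρ _ hq] at h5 h6 ⊢
      unfold progress at h5 h6 ⊢
      obtain ⟨e1, e2⟩ := State.level_eq_even.1 (level_entered_of_tick h5)
      rw [(tick_frame _ _ _ _ _).2.2.2.1]
      rw [(tick_frame _ _ _ _ _).2.2.2.2.1] at h6
      refine exists_mem_supportProposals e2 (T := T') ?_ e1.symm (by omega)
      rw [(entered_frame _ _ _ _).1]
      exact List.mem_append_left _ h4
    obtain ⟨T'', h7⟩ := hex
    obtain rfl := proposed_of_supported ρ hu hp hq hZp
      (hlev p hp (Z + Δ + 1) (by omega) (by omega)) hi h7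
    exact h7
  -- the primary certifies its proposals
  have hcert : ∀ i T', (ρ.state Z p).proposed[i]? = some T' → ∃ S, cfg.nf n ≤ S.card ∧
      (p, Msg.certify ⟨T', u, (ρ.state Z p).base + i, S⟩) ∈
        (ρ.state (Z + 3 * Δ + 2) p).inbox := by
    intro i T' hi
    have h2 := hlev p hp (Z + 2 * Δ + 1 + 1) (by omega) (by omega)
    have h3 := hbase p hp (Z + 2 * Δ + 1 + 1) (by omega) (by omega)
    have hi2 := (proposed_persists ρ hp (show Z ≤ Z + 2 * Δ + 1 + 1 by omega) hZp h2 hi).2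
    -- All non-faulty replicas have supported by `Z + Δ + 1`, so their shares, a quorum, have
    -- arrived one delay later.
    have hin : ∀ q ∉ F, (q, Msg.support T' u ((ρ.state Z p).base + i)) ∈
        (ρ.state (Z + 2 * Δ + 1 + 1) p).inbox := by
      intro q hq
      obtain ⟨⟨s, e1, e2, e3⟩, -⟩ := sent_of_supported ρ hp hq (hsup q hq i T' hi)
      exact hrel.mem_inbox (hsent q hq s e2) (by omega) hq hp e3 (by omega)
    have hmem : (ρ.state Z p).base + i ∈ (ρ.state (Z + 2 * Δ + 1 + 1) p).certified := by
      rw [← h3]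
      rw [← h3] at hin
      have hin' : ∀ q ∉ F, q ∈ supporters (ρ.state (Z + 2 * Δ + 1 + 1) p) T' u
          ((ρ.state (Z + 2 * Δ + 1 + 1) p).base + i) := by
        intro q hq
        simp only [supporters, Finset.mem_filter, Finset.mem_univ, true_and, List.any_eq_true]
        exact ⟨_, hin q hq, by simp⟩
      have hcard := nf_le_card hf hin'
      rw [state_succ' ρ _ hp] at hcard hi2 h2 ⊢
      unfold progress at hcard hi2 h2 ⊢
      obtain ⟨e1, e2⟩ := State.level_eq_even.1 (level_entered_of_tick h2)
      rw [(tick_frame _ _ _ _ _).2.2.2.2.2.1] at hi2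
      rw [(tick_frame _ _ _ _ _).2.2.2.2.1] at hcard ⊢
      rw [(tick_frame _ _ _ _ _).2.2.2.2.2.2.1, normalCase]
      have := mem_certifyProposals (cfg := cfg) (me := p) (a := proposeRequests p (execute cfg
        (supportProposals (entered cfg (ρ.state (Z + 2 * Δ + 1) p)
          (ρ.requests (Z + 2 * Δ + 1) p) (ρ.delivered (Z + 2 * Δ + 1) p)))))
        (by simpa using e2)
        (by
          simp only [proposeRequests_frame, execute_frame, supportProposals_frame, e1]
          exact hpu) hi2 (by
          simp only [proposeRequests_frame, execute_frame, supportProposals_frame, e1]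
          refine hcard.trans_eq (congrArg Finset.card ?_)
          unfold supporters
          simp only [proposeRequests_frame, execute_frame, supportProposals_frame, tick_frame,
            entered_frame])
      simpa using this
    obtain ⟨i', T'', S, e1, e2, e3, s, e4, e5, e6⟩ := (primary_invariant ρ hu hp h2).2 _ hmem
    rw [h3] at e1
    obtain rfl : i = i' := by omega
    rw [hi2] at e2
    obtain rfl := Option.some.inj e2
    exact ⟨S, e3, hrel.mem_inbox (hsent p hp s e5) (by omega) hp hp (e6 p) (by omega)⟩
  -- the transactions are executed
  have h1 := hlev p hp (Z + 3 * Δ + 2 + 1) (by omega) (by omega)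
  have h2 := hbase p hp (Z + 3 * Δ + 2 + 1) (by omega) (by omega)
  obtain ⟨-, h3, h4⟩ := backup_invariant ρ hu hp hp h1
  -- Otherwise the next free slot of the log is a proposed one, `base + i` with `i ≤ j`; it is
  -- supported and its certificate has arrived, contrary to `execute_exhaustive`. The earlier slots
  -- matter because execution is in order.
  have hlen : (ρ.state Z p).base + j < (ρ.state (Z + 3 * Δ + 2 + 1) p).log.length := by
    by_contra hcon
    obtain ⟨i, hi⟩ : ∃ i, (ρ.state (Z + 3 * Δ + 2 + 1) p).log.length =
        (ρ.state Z p).base + i := ⟨(ρ.state (Z + 3 * Δ + 2 + 1) p).log.length -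
          (ρ.state Z p).base, by omega⟩
    have hilt : i < (ρ.state Z p).proposed.length := by omega
    obtain ⟨T', hT'⟩ : ∃ T', (ρ.state Z p).proposed[i]? = some T' :=
      ⟨_, List.getElem?_eq_getElem hilt⟩
    obtain ⟨S, hS, hin⟩ := hcert i T' hT'
    have hsup' := supported_mono ρ hp (show Z + Δ + 1 ≤ Z + 3 * Δ + 2 + 1 by omega)
      (hsup p hp i T' hT')
    rw [state_succ' ρ _ hp] at h1 hi hsup'
    unfold progress at h1 hi hsup'
    obtain ⟨e1, e2⟩ := State.level_eq_even.1 (level_entered_of_tick h1)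
    rw [(tick_frame _ _ _ _ _).1] at hi
    rw [(tick_frame _ _ _ _ _).2.2.2.1] at hsup'
    refine execute_exhaustive (cfg := cfg) (a := supportProposals (entered cfg
      (ρ.state (Z + 3 * Δ + 2) p) (ρ.requests (Z + 3 * Δ + 2) p)
      (ρ.delivered (Z + 3 * Δ + 2) p))) (by simpa using e2) (p := p)
      (c := ⟨T', u, (ρ.state Z p).base + i, S⟩) ?_ ?_ hi.symm
    · simp only [supportProposals_frame, entered_frame]
      exact List.mem_append_left _ hin
    · refine viewCommits_iff.2 ⟨⟨hpu, ?_, hsup'⟩, by simpa [Cert.valid] using hS⟩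
      simp [e1]
  obtain ⟨c, hc⟩ : ∃ c, (ρ.state (Z + 3 * Δ + 2 + 1) p).log[(ρ.state Z p).base + j]? = some c :=
    ⟨_, List.getElem?_eq_getElem hlen⟩
  -- The slot of `T` is filled with something supported in this view, hence with `T`, which
  -- therefore no longer waits at the primary.
  have h5 := h4 _ c (by omega) hc
  have h6 := proposed_of_supported ρ hu hp hp hZp h1 hj h5
  exact (State.pending_iff.1 (hT (Z + 3 * Δ + 2 + 1) (by omega) (by omega))).2 c
    (List.mem_of_getElem? hc) h6

end Run


/-! ### The window in which all replicas share a view, and the choice of constants -/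

namespace Run

variable {n : ℕ} [NeZero n] {Req : Type*} [DecidableEq Req] {F : Finset (Fin n)} {cfg : Config}

theorem Reliable.mono {ρ : Run n Req F cfg} {Δ a a' b : ℕ} (h : ρ.Reliable Δ a b) (ha : a ≤ a') :
    ρ.Reliable Δ a' b := fun s hs => h s (ha.trans hs)

/-- No request waits at all non-faulty replicas for a long time. -/
theorem not_all_pending (ρ : Run n Req F cfg) (hf : cfg.f = F.card) (hδ : 0 < cfg.δ)
    {Δ W u a b : ℕ} (hrel : ρ.Reliable Δ a b) (hp : primary n u ∉ F)
    (hW : ∀ q ∉ F, (ρ.state a q).level ≤ 2 * W) (hWu : W + 2 ≤ u) (hΔu : 5 * Δ + 7 ≤ u)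
    (hb : a + cfg.δ * 2 ^ (u + 1) ≤ b) {T : Req}
    (hT : ∀ q ∉ F, ∀ t, a ≤ t → t ≤ a + cfg.δ * 2 ^ (u + 1) →
      (ρ.state t q).pending T = true) : False := by
  obtain ⟨w, rfl⟩ : ∃ w, u = w + 1 := ⟨u - 1, by omega⟩
  have h1 : cfg.δ * 2 ^ (w + 1 + 1) = cfg.δ * 2 ^ (w + 1) + cfg.δ * 2 ^ (w + 1) := by ring
  have h2 : cfg.δ * 2 ^ (w + 1) = cfg.δ * 2 ^ w + cfg.δ * 2 ^ w := by ring
  have h3 : cfg.δ * 2 ^ (W + 1) ≤ cfg.δ * 2 ^ w :=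
    Nat.mul_le_mul_left _ (Nat.pow_le_pow_right (by norm_num) (by omega))
  -- With `u = w + 1`, the window from `δ * 2 ^ u` to `δ * 2 ^ (u + 1) - δ * 2 ^ (W + 1)` has length
  -- at least `δ * 2 ^ w ≥ w + 1 = u ≥ 5 * Δ + 7`.
  have h4 : w < 2 ^ w := Nat.lt_two_pow_self
  have h5 : 2 ^ w ≤ cfg.δ * 2 ^ w := Nat.le_mul_of_pos_left _ hδ
  refine not_pending_of_view ρ hf hrel (u := w + 1) (X := a + cfg.δ * 2 ^ (w + 1)) (by omega) hp
    (fun q hq => ?_) (fun q hq => ?_) (fun q hq => ?_) (by omega)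
    (fun t ht1 ht2 => hT _ hp t (by omega) (by omega))
  · have := hW q hq
    omega
  · have := level_ge ρ hδ hq (T := T) (a := a) w
      (fun t ht1 ht2 => hT q hq t ht1 (by omega))
    omega
  · have hk : W + (w + 1 - W) = w + 1 := by omega
    have := level_le ρ hf hW (w + 1 - W) (cfg.δ * 2 ^ (w + 1 + 1) - cfg.δ * 2 ^ (W + 1))
      (by rw [hk]; omega) q hq
    rw [hk] at this
    exact (level_mono ρ hq (by omega)).trans this

end Run

/-- The primaries rotate, so every replica is the primary of arbitrarily late views. -/
theorem primary_add_mul {n : ℕ} [NeZero n] (p : Fin n) (m : ℕ) :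
    primary n (p.val + n * m) = p := by
  apply Fin.ext
  simp [primary, Fin.ofNat, Nat.mod_eq_of_lt p.isLt]

end PoE

theorem mainTheorem2 (n : ℕ) [NeZero n] (Req : Type*) [DecidableEq Req] (F : Finset (Fin n))
    (hF : 3 * F.card < n) (δ period Δ V : ℕ) (hδ : 0 < δ) (hperiod : 0 < period) :
    ∃ L : ℕ, ∀ (ρ : PoE.Run n Req F ⟨F.card, δ, period⟩) (a : ℕ),
      ρ.Reliable Δ a (a + L) →
      (∀ r ∉ F, (ρ.state a r).view ≤ V) →
      ∀ T : Req, (∀ r ∉ F, T ∈ (ρ.state a r).known) →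
        ∀ r ∉ F, ρ.Executes r T a (a + L) := by
  obtain ⟨p, hp⟩ : ∃ p, p ∉ F := by
    by_contra! h
    have h1 := Finset.card_le_card (fun q _ => h q : Finset.univ ⊆ F)
    rw [Finset.card_univ, Fintype.card_fin] at h1
    omega
  -- A view with primary `p`, late enough both to be ahead of all views reached by `a + period` and
  -- to have a window of sufficient length.
  obtain ⟨u, hu, hpu⟩ : ∃ u, V + period + 5 * Δ + 7 ≤ u ∧ PoE.primary n u = p := by
    refine ⟨_, ?_, PoE.primary_add_mul p (V + period + 5 * Δ + 7)⟩
    have := Nat.le_mul_of_pos_left (V + period + 5 * Δ + 7) (NeZero.pos n)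
    omega
  set N := δ * 2 ^ (u + 1) with hN
  -- The summands of `L`: `period` ticks until logs of `q` are known to have been broadcast after
  -- `a`, `N` ticks of common waiting, `Δ` for a checkpoint to arrive, and one timeout in the
  -- highest view that `r` can have reached by then.
  refine ⟨period + N + Δ + δ * 2 ^ (V + (period + N + Δ)) + 1, ?_⟩
  intro ρ a hrel hV T hk r hr
  by_contra hne
  refine ρ.not_all_pending rfl hδ (hrel.mono (Nat.le_add_right a period)) (W := V + period + 1)
    (u := u) (hpu ▸ hp) (fun q hq => ?_) (by omega) (by omega) ?_ (T := T)
    (fun q hq t h1 h2 => ?_)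
  · have h1 := ρ.level_add_le hq a period
    have h2 := hV q hq
    unfold PoE.State.level at h1 ⊢
    split at h1 <;> split at h1 <;> split <;> omega
  · dsimp only
    omega
  · exact ρ.all_pending_of_not_executes hδ hperiod (N := N) (by dsimp only; omega) hrel hV hk hr
      hne hq h1 h2
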